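/- Let $A$ be a Noetherian commutative ring with a good dimension function, that is, an assignment of an integer $\dim A/\mathfrak p$ to every prime ideal $\mathfrak p$ of $A$ such that $\dim A/\mathfrak p=\dim A/\mathfrak q+1$ whenever $\mathfrak p\subsetneq\mathfrak q$ are primes with no prime strictly between them. Assume also that, for every prime $\mathfrak p$, the normalization (integral closure in the fraction field) of $A/\mathfrak p$ is a finitely generated $A/\mathfrak p$-module. Let $Z_i(A)$ be the free abelian group on the symbols $[A/\mathfrak p]$ with $\mathfrak p$ prime and $\dim A/\mathfrak p=i$, and let $Z_*(A)=\bigoplus_i Z_i(A)$. For a prime $\mathfrak p$ with $\dim A/\mathfrak p=i+1$ and $x\in A\setminus\mathfrak p$ put $$\operatorname{div}(\mathfrak p,x)=\sum_{\dim A/\mathfrak q=i}\ell_{A_{\mathfrak q}}\bigl(A_{\mathfrak q}/(\mathfrak p,x)A_{\mathfrak q}\bigr)\,[A/\mathfrak q]\in Z_i(A).$$ Two elements of $Z_i(A)$ are rationally equivalent if their difference lies in the subgroup generated by all $\operatorname{div}(\mathfrak p,x)$ with $\dim A/\mathfrak p=i+1$ and $x\notin\mathfrak p$. For an ideal $I$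 of $A$, the primes of $A/I$ are identified with the primes of $A$ containing $I$ and are given the same dimensions; thus $Z_i(A/I)\subseteq Z_i(A)$, and rational equivalence in $Z_i(A/I)$ is defined by the same recipe applied to the ring $A/I$. For $u\in A$ let $(u)\cap -\colon Z_*(A)\to Z_*(A/uA)$ be the additive map with $$(u)\cap[A/\mathfrak p]=\begin{cases}0,&u\in\mathfrak p,\\ \operatorname{div}(\mathfrak p,u),&u\notin\mathfrak p.\end{cases}$$ **Theorem.** Let $u,v\in A$, let $i$ be an integer and let $\alpha\in Z_i(A)$. Then the cycles $(u)\cap(v)\cap\alpha$ and $(v)\cap(u)\cap\alpha$ both lie in $Z_{i-2}(A/(u,v))$, and they are rationally equivalent in $Z_{i-2}(A/(u,v))$. -/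

import Mathlib

/-- A good dimension function on `A`: an integer `δ 𝔭`, thought of as the dimension of `A/𝔭`, for
every prime ideal `𝔭`, such that `δ 𝔭 = δ 𝔮 + 1` whenever `𝔭 ⊊ 𝔮` are primes with no prime
strictly between them. -/
structure DimensionFunction (A : Type*) [CommRing A] where
  /-- The dimension of `A/𝔭`. -/
  dim : PrimeSpectrum A → ℤ
  dim_of_covBy : ∀ {p q : PrimeSpectrum A}, p ⋖ q → dim p = dim q + 1

namespace DimensionFunction

variable {A : Type*} [CommRing A]

theorem comap_covBy {I : Ideal A} {p q : PrimeSpectrum (A ⧸ I)} (h : p ⋖ q) :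
    PrimeSpectrum.comap (Ideal.Quotient.mk I) p ⋖
      PrimeSpectrum.comap (Ideal.Quotient.mk I) q := by
  let e := I.primeSpectrumQuotientOrderIsoZeroLocus
  have h1 : e p ⋖ e q := (apply_covBy_apply_iff e).2 h
  refine ⟨h1.1, fun {c} hc hc' => ?_⟩
  have hcI : c ∈ PrimeSpectrum.zeroLocus (I : Set A) := fun x hx => hc.le ((e p).2 hx)
  exact h1.2 (c := ⟨c, hcI⟩) hc hc'

/-- The dimension function induced on `A/I`: a prime of `A/I` has the dimension of its preimage
in `A`, the two residue rings being the same. -/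
def quotient (δ : DimensionFunction A) (I : Ideal A) : DimensionFunction (A ⧸ I) where
  dim p := δ.dim (PrimeSpectrum.comap (Ideal.Quotient.mk I) p)
  dim_of_covBy h := δ.dim_of_covBy (comap_covBy h)

theorem dim_lt_of_lt [IsNoetherianRing A] (δ : DimensionFunction A) (q : PrimeSpectrum A) :
    ∀ p < q, δ.dim q < δ.dim p := by
  have wf : WellFounded (fun a b : PrimeSpectrum A => a < b) := by
    refine (measure fun a : PrimeSpectrum A => a.asIdeal.height.toNat).wf.mono fun a b hab => ?_
    have hb : b.asIdeal.height ≠ ⊤ := Ideal.height_ne_top_of_isPrime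
    have hlt : a.asIdeal.height < b.asIdeal.height :=
      Ideal.height_strict_mono_of_isPrime hab
    change a.asIdeal.height.toNat < b.asIdeal.height.toNat
    rw [← ENat.natCast_lt_natCast, ENat.natCast_toNat hb, ENat.natCast_toNat hlt.ne_top]
    exact hlt
  induction q using wf.induction with
  | _ q ih =>
    intro p hpq
    obtain ⟨r, ⟨hpr, hrq⟩, hmax⟩ : ∃ r ∈ {r : PrimeSpectrum A | p ≤ r ∧ r < q},
        ∀ s ∈ {r : PrimeSpectrum A | p ≤ r ∧ r < q}, ¬ r < s := by
      have wf' : WellFounded (fun a b : PrimeSpectrum A => b < a) :=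
        InvImage.wf PrimeSpectrum.asIdeal (wellFounded_gt (α := Ideal A))
      obtain ⟨r, hr, h⟩ := wf'.has_min {r : PrimeSpectrum A | p ≤ r ∧ r < q} ⟨p, le_rfl, hpq⟩
      exact ⟨r, hr, h⟩
    have hcov : r ⋖ q := ⟨hrq, fun {c} hc hc' => hmax c ⟨hpr.trans hc.le, hc'⟩ hc⟩
    have h1 := δ.dim_of_covBy hcov
    rcases hpr.eq_or_lt with rfl | hlt
    · omega
    · have := ih r hrq p hlt
      omega

end DimensionFunction

/-- The group `Z_*(A)` of cycles on `A`: the free abelian group on the prime ideals of `A`.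
The basis element `[A/𝔭]` is `Finsupp.single 𝔭 1`. -/
abbrev PrimeCycle (A : Type*) [CommRing A] : Type _ := PrimeSpectrum A →₀ ℤ

namespace PrimeCycle

variable {A : Type*} [CommRing A]

/-- The group `Z_i(A)` of cycles of dimension `i`, as a subgroup of `Z_*(A)`: it is free on the
primes `𝔭` with `dim A/𝔭 = i`. -/
noncomputable def ofDim (δ : DimensionFunction A) (i : ℤ) : AddSubgroup (PrimeCycle A) :=
  (Finsupp.supported ℤ ℤ {p : PrimeSpectrum A | δ.dim p = i}).toAddSubgroup

/-- The length of the `A_𝔮`-module `A_𝔮/(𝔭, x)A_𝔮`. -/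
noncomputable def localLength (p : PrimeSpectrum A) (x : A) (q : PrimeSpectrum A) : ℕ∞ :=
  Module.length (Localization.AtPrime q.asIdeal)
    (Localization.AtPrime q.asIdeal ⧸
      (p.asIdeal ⊔ Ideal.span {x}).map (algebraMap A (Localization.AtPrime q.asIdeal)))

theorem le_of_localLength_ne_zero {p : PrimeSpectrum A} {x : A} {q : PrimeSpectrum A}
    (h : localLength p x q ≠ 0) : p.asIdeal ⊔ Ideal.span {x} ≤ q.asIdeal := by
  by_contra hle
  apply h
  obtain ⟨y, hy, hyq⟩ := Set.not_subset.1 hle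
  have htop : (p.asIdeal ⊔ Ideal.span {x}).map
      (algebraMap A (Localization.AtPrime q.asIdeal)) = ⊤ :=
    Ideal.eq_top_of_isUnit_mem _ (Ideal.mem_map_of_mem _ hy)
      (IsLocalization.map_units (M := q.asIdeal.primeCompl) _ ⟨y, hyq⟩)
  rw [localLength, htop]
  exact Module.length_eq_zero_iff.2 inferInstance

theorem mem_minimalPrimes [IsNoetherianRing A] (δ : DimensionFunction A) {p : PrimeSpectrum A}
    {x : A} (hx : x ∉ p.asIdeal) {q : PrimeSpectrum A} (hq : δ.dim p = δ.dim q + 1)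
    (hle : p.asIdeal ⊔ Ideal.span {x} ≤ q.asIdeal) :
    q.asIdeal ∈ (p.asIdeal ⊔ Ideal.span {x}).minimalPrimes := by
  refine ⟨⟨q.isPrime, hle⟩, fun r hr hrq => ?_⟩
  by_contra hqr
  let r' : PrimeSpectrum A := ⟨r, hr.1⟩
  have h1 : p < r' := by
    refine lt_of_le_of_ne (le_sup_left.trans hr.2) fun h => hx ?_
    rw [h]
    exact hr.2 (le_sup_right (a := p.asIdeal) (Ideal.mem_span_singleton_self x))
  have h2 : r' < q := lt_of_le_not_ge hrq hqr
  have := δ.dim_lt_of_lt r' p h1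
  have := δ.dim_lt_of_lt q r' h2
  omega

/-- The lengths that occur in `div(𝔭, x)` are finite. -/
theorem localLength_ne_top [IsNoetherianRing A] (δ : DimensionFunction A) {p : PrimeSpectrum A}
    {x : A} (hx : x ∉ p.asIdeal) {q : PrimeSpectrum A} (hq : δ.dim p = δ.dim q + 1) :
    localLength p x q ≠ ⊤ := by
  by_cases h0 : localLength p x q = 0
  · simp [h0]
  have hmin := mem_minimalPrimes δ hx hq (le_of_localLength_ne_zero h0)
  set L := Localization.AtPrime q.asIdeal
  set J : Ideal L := (p.asIdeal ⊔ Ideal.span {x}).map (algebraMap A L) with hJ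
  have hrad : J.radical = IsLocalRing.maximalIdeal L := by
    rw [hJ, IsLocalization.AtPrime.radical_map_of_mem_minimalPrimes L q.asIdeal _ hmin,
      IsLocalization.AtPrime.map_eq_maximalIdeal q.asIdeal L]
  have hdim : Ring.KrullDimLE 0 (L ⧸ J) := by
    refine Ring.krullDimLE_zero_iff.2 fun P hP => ?_
    have hPc : P.comap (Ideal.Quotient.mk J) = IsLocalRing.maximalIdeal L := by
      refine le_antisymm (IsLocalRing.le_maximalIdeal (Ideal.IsPrime.comap _).ne_top) ?_
      rw [← hrad]
      refine (Ideal.IsPrime.radical_le_iff (Ideal.IsPrime.comap _)).2 fun y hy => ?_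
      rw [Ideal.mem_comap, Ideal.Quotient.eq_zero_iff_mem.2 hy]
      exact P.zero_mem
    have : (P.comap (Ideal.Quotient.mk J)).IsMaximal := hPc ▸ inferInstance
    have h2 := Ideal.IsMaximal.map_of_surjective_of_ker_le
      (f := Ideal.Quotient.mk J) Ideal.Quotient.mk_surjective
      (m := P.comap (Ideal.Quotient.mk J)) (Ideal.comap_mono bot_le)
    rwa [Ideal.map_comap_of_surjective _ Ideal.Quotient.mk_surjective] at h2
  have : IsArtinianRing (L ⧸ J) := IsNoetherianRing.isArtinianRing_of_krullDimLE_zero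
  have : IsArtinian L (L ⧸ J) :=
    isArtinian_of_surjective_algebraMap (R := L ⧸ J) (S := L) Ideal.Quotient.mk_surjective
  exact Module.length_ne_top

theorem finite_support_divCoeff [IsNoetherianRing A] (δ : DimensionFunction A)
    (p : PrimeSpectrum A) {x : A} (hx : x ∉ p.asIdeal) :
    (Function.support fun q : PrimeSpectrum A =>
      if δ.dim p = δ.dim q + 1 then ((localLength p x q).toNat : ℤ) else 0).Finite := by
  refine Set.Finite.of_finite_image (f := PrimeSpectrum.asIdeal)
    (((p.asIdeal ⊔ Ideal.span {x}).finite_minimalPrimes_of_isNoetherianRing A).subset ?_)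
    (fun a _ b _ h => PrimeSpectrum.ext h)
  rintro _ ⟨q, hq, rfl⟩
  rw [Function.mem_support] at hq
  split_ifs at hq with hd
  · refine mem_minimalPrimes δ hx hd (le_of_localLength_ne_zero fun h0 => hq ?_)
    simp [h0]
  · exact absurd rfl hq

/-- For a prime `𝔭` with `dim A/𝔭 = i + 1` and `x ∉ 𝔭`, the cycle
`div(𝔭, x) = ∑ ℓ(A_𝔮/(𝔭, x)A_𝔮) [A/𝔮]`, the sum over all primes `𝔮` with `dim A/𝔮 = i`. -/
noncomputable def div [IsNoetherianRing A] (δ : DimensionFunction A) (p : PrimeSpectrum A) (x : A)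
    (hx : x ∉ p.asIdeal) : PrimeCycle A :=
  Finsupp.ofSupportFinite
    (fun q => if δ.dim p = δ.dim q + 1 then ((localLength p x q).toNat : ℤ) else 0)
    (finite_support_divCoeff δ p hx)

/-- The subgroup of cycles of dimension `i` rationally equivalent to zero, generated by the
cycles `div(𝔭, x)` with `dim A/𝔭 = i + 1` and `x ∉ 𝔭`. -/
noncomputable def ratTrivial [IsNoetherianRing A] (δ : DimensionFunction A) (i : ℤ) : AddSubgroup (PrimeCycle A) :=
  AddSubgroup.closure
    {c | ∃ (p : PrimeSpectrum A) (x : A) (hx : x ∉ p.asIdeal), δ.dim p = i + 1 ∧ c = div δ p x hx}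

/-- Rational equivalence in `Z_i(A)`. -/
def RatEquiv [IsNoetherianRing A] (δ : DimensionFunction A) (i : ℤ) (a b : PrimeCycle A) : Prop :=
  a ∈ ofDim δ i ∧ b ∈ ofDim δ i ∧ a - b ∈ ratTrivial δ i

/-- The inclusion `Z_*(A/I) → Z_*(A)` that regards a prime of `A/I` as a prime of `A` containing
`I`. -/
noncomputable def incl (I : Ideal A) : PrimeCycle (A ⧸ I) →+ PrimeCycle A :=
  Finsupp.mapDomain.addMonoidHom (PrimeSpectrum.comap (Ideal.Quotient.mk I))

theorem comap_mk_injective (I : Ideal A) :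
    Function.Injective (PrimeSpectrum.comap (Ideal.Quotient.mk I)) :=
  PrimeSpectrum.comap_injective_of_surjective _ Ideal.Quotient.mk_surjective

open Classical in
/-- Intersection with `(u)` of a basis element `[A/𝔭]`, as a cycle on `A/uA`: zero if `u ∈ 𝔭`,
and otherwise `div(𝔭, u)`, read through the identification of the primes of `A/uA` with the primes
of `A` that contain `u`. -/
noncomputable def capPrime [IsNoetherianRing A] (δ : DimensionFunction A) (u : A)
    (p : PrimeSpectrum A) : PrimeCycle (A ⧸ Ideal.span {u}) :=
  if h : u ∈ p.asIdeal then 0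
  else (div δ p u h).comapDomain (PrimeSpectrum.comap (Ideal.Quotient.mk (Ideal.span {u})))
    (comap_mk_injective _).injOn

/-- Nothing is lost in reading `div(𝔭, u)` as a cycle on `A/uA`. -/
theorem incl_capPrime [IsNoetherianRing A] (δ : DimensionFunction A) (u : A)
    (p : PrimeSpectrum A) (h : u ∉ p.asIdeal) :
    incl (Ideal.span {u}) (capPrime δ u p) = div δ p u h := by
  rw [capPrime, dif_neg h]
  refine Finsupp.mapDomain_comapDomain _ (comap_mk_injective _) _ fun q hq => ?_
  have hq' : (if δ.dim p = δ.dim q + 1 then ((localLength p u q).toNat : ℤ) else 0) ≠ 0 :=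
    Finsupp.mem_support_iff.1 hq
  split_ifs at hq' with hd
  · have hle := le_of_localLength_ne_zero (p := p) (x := u) (q := q) fun h0 => hq' (by simp [h0])
    rw [range_comap_of_surjective _ _ Ideal.Quotient.mk_surjective, Ideal.mk_ker]
    exact le_sup_right.trans hle
  · exact absurd rfl hq'

/-- Intersection with `(u)`, the additive map `(u) ∩ - : Z_*(A) → Z_*(A/uA)`. -/
noncomputable def cap [IsNoetherianRing A] (δ : DimensionFunction A) (u : A) :
    PrimeCycle A →+ PrimeCycle (A ⧸ Ideal.span {u}) :=
  (Finsupp.linearCombination ℤ (capPrime δ u)).toAddMonoidHom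

end PrimeCycle

/-! By additivity a single prime `p` suffices, and if `u` or `v` lies in `p` both cycles vanish.
Otherwise let `B` be the normalization of `A/p`, a finite birational extension, and call a prime `Q`
of `B` divisorial if its contraction has dimension `dim p - 1`. Comparing lengths over `A` and over
`B` shows that the coefficient of `(u) ∩ (v) ∩ [A/p]` at `q` is the sum of `ord_Q(v) · ℓ_q(B/(Q,
u))` over the divisorial `Q` that contain `v` but not `u` (`PrimeCycle.incl_cap_div_apply`). So the
difference of the two cycles has as its coefficient at `q` the sum of the orders at `q` of the tame
symbols of `u` and `v` at those `Q` that contain exactly one of them.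

Reciprocity (`tameSum_eq_zero`) says that the orders of the tame symbols at all divisorial `Q` add
up to zero. Hence the difference is minus the sum over the `Q` that contain both `u` and `v`. There
the tame symbol is a fraction `c/d` in the residue field of `Q`, and its order function is the
divisor of a norm down to the contraction of `Q` (`exists_localizedLength_eq_norm`). That
contraction contains `u` and `v`, so the relation lives on `A/(u, v)`.

For reciprocity, suppose first that no divisorial prime contains both elements. Then it is the
symmetry in `u` and `v` of the kernel and cokernel of `u` on `B/v` (`tameSum_eq_zero_of_coprime`).
In general the sum of the orders is bimultiplicative and antisymmetric, and it depends on `u` only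
through its orders at the divisorial primes containing `v` (`tameSum_congr_left`). As `B` is normal,
its localizations at divisorial primes are discrete valuation rings, and prime avoidance reduces the
claim to two uniformizers of one prime. A third uniformizer shows that the sum for these is
symmetric as well, so it is zero (`tameSum_eq_zero_of_uniformizer`). -/

/-! ### Lengths at a prime, exact sequences and the snake lemma. -/

/-- The length of the localization of the `A`-module `M` at the prime `q`. -/
noncomputable def localizedLength {A : Type*} [CommRing A] (q : PrimeSpectrum A) (M : Type*)
    [AddCommGroup M] [Module A M] : ℕ∞ :=
  Module.length (Localization.AtPrime q.asIdeal) (LocalizedModule q.asIdeal.primeCompl M)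

theorem ENat.add_ne_top_of_ne_top {a b : ℕ∞} (ha : a ≠ ⊤) (hb : b ≠ ⊤) : a + b ≠ ⊤ :=
  WithTop.add_ne_top.2 ⟨ha, hb⟩

section LocalizedLength

variable {A : Type*} [CommRing A] (q : PrimeSpectrum A)
  {M N P : Type*} [AddCommGroup M] [Module A M] [AddCommGroup N] [Module A N]
  [AddCommGroup P] [Module A P]

theorem localizedLength_eq_length {M' : Type*} [AddCommGroup M'] [Module A M']
    [Module (Localization.AtPrime q.asIdeal) M']
    [IsScalarTower A (Localization.AtPrime q.asIdeal) M'] (f : M →ₗ[A] M')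
    [IsLocalizedModule q.asIdeal.primeCompl f] :
    Module.length (Localization.AtPrime q.asIdeal) M' = localizedLength q M :=
  ((IsLocalizedModule.linearEquiv q.asIdeal.primeCompl f
    (LocalizedModule.mkLinearMap q.asIdeal.primeCompl M)).extendScalarsOfIsLocalization
      q.asIdeal.primeCompl (Localization.AtPrime q.asIdeal)).length_eq

theorem localizedLength_eq_add_of_exact {f : N →ₗ[A] M} {g : M →ₗ[A] P}
    (hf : Function.Injective f) (hg : Function.Surjective g) (H : Function.Exact f g) :
    localizedLength q M = localizedLength q N + localizedLength q P :=
  Module.length_eq_add_of_exact (LocalizedModule.map q.asIdeal.primeCompl f)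
    (LocalizedModule.map q.asIdeal.primeCompl g)
    (LocalizedModule.map_injective _ f hf) (LocalizedModule.map_surjective _ g hg)
    (LocalizedModule.map_exact _ f g H)

theorem LinearEquiv.localizedLength_eq (e : M ≃ₗ[A] N) :
    localizedLength q M = localizedLength q N := by
  refine le_antisymm ?_ ?_
  · exact Module.length_le_of_injective _ (LocalizedModule.map_injective _ e.toLinearMap e.injective)
  · exact Module.length_le_of_surjective _
      (LocalizedModule.map_surjective _ e.toLinearMap e.surjective)

theorem localizedLength_eq_zero_iff :
    localizedLength q M = 0 ↔ ∀ x : M, ∃ a ∉ q.asIdeal, a • x = 0 := by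
  rw [localizedLength, Module.length_eq_zero_iff, LocalizedModule.subsingleton_iff]
  rfl

theorem localizedLength_eq_zero_of_subsingleton [Subsingleton M] : localizedLength q M = 0 :=
  (localizedLength_eq_zero_iff q).2 fun _ =>
    ⟨1, (Ideal.ne_top_iff_one _).1 q.isPrime.ne_top, Subsingleton.elim _ _⟩

theorem localizedLength_le_of_injective {f : N →ₗ[A] M} (hf : Function.Injective f) :
    localizedLength q N ≤ localizedLength q M := by
  rw [localizedLength_eq_add_of_exact q hf (Submodule.mkQ_surjective _)
    (LinearMap.exact_map_mkQ_range f)]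
  exact le_self_add

theorem localizedLength_eq_ker_add_range (f : M →ₗ[A] N) :
    localizedLength q M = localizedLength q (LinearMap.ker f) +
      localizedLength q (LinearMap.range f) :=
  localizedLength_eq_add_of_exact q (Submodule.subtype_injective _) f.surjective_rangeRestrict
    (by
      rw [LinearMap.exact_iff, LinearMap.ker_rangeRestrict, Submodule.range_subtype])

/-- An alternating sum of lengths in the snake lemma, for compatible endomorphisms of the terms
of a short exact sequence. -/
theorem localizedLength_snake {f : N →ₗ[A] M} {g : M →ₗ[A] P}
    (hf : Function.Injective f) (hg : Function.Surjective g) (H : Function.Exact f g)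
    (φN : N →ₗ[A] N) (φM : M →ₗ[A] M) (φP : P →ₗ[A] P)
    (h₁ : f ∘ₗ φN = φM ∘ₗ f) (h₂ : g ∘ₗ φM = φP ∘ₗ g) :
    localizedLength q (LinearMap.ker φN) + localizedLength q (LinearMap.ker φP) +
        localizedLength q (M ⧸ LinearMap.range φM) =
      localizedLength q (LinearMap.ker φM) + localizedLength q (N ⧸ LinearMap.range φN) +
        localizedLength q (P ⧸ LinearMap.range φP) ∧
      localizedLength q (LinearMap.ker φM) ≤
        localizedLength q (LinearMap.ker φN) + localizedLength q (LinearMap.ker φP) := by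
  have e₁ (x) : f (φN x) = φM (f x) := congr($h₁ x)
  have e₂ (x) : g (φM x) = φP (g x) := congr($h₂ x)
  let a : LinearMap.ker φN →ₗ[A] LinearMap.ker φM := f.restrict fun x hx => by
    simp only [LinearMap.mem_ker] at hx ⊢
    rw [← e₁, hx, map_zero]
  let b : LinearMap.ker φM →ₗ[A] LinearMap.ker φP := g.restrict fun x hx => by
    simp only [LinearMap.mem_ker] at hx ⊢
    rw [← e₂, hx, map_zero]
  let G : (N ⧸ LinearMap.range φN) →ₗ[A] (M ⧸ LinearMap.range φM) :=
    Submodule.mapQ _ _ f (by rintro _ ⟨x, rfl⟩; exact ⟨f x, (e₁ x).symm⟩)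
  let K : (M ⧸ LinearMap.range φM) →ₗ[A] (P ⧸ LinearMap.range φP) :=
    Submodule.mapQ _ _ g (by rintro _ ⟨x, rfl⟩; exact ⟨g x, (e₂ x).symm⟩)
  let d := SnakeLemma.δ' φN φM φP f g H f g H h₁ h₂
    (LinearMap.ker φP).subtype (LinearMap.exact_subtype_ker_map _)
    (LinearMap.range φN).mkQ (LinearMap.exact_map_mkQ_range _) hg hf
  have ha : Function.Injective a := fun x y hxy => Subtype.ext (hf congr(($hxy).1))
  have hab : Function.Exact a b := by
    intro x
    constructor
    · intro hx
      obtain ⟨y, hy⟩ := (H x.1).1 congr(($hx).1)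
      refine ⟨⟨y, hf ?_⟩, Subtype.ext hy⟩
      rw [e₁, hy, map_zero]
      exact x.2
    · rintro ⟨y, rfl⟩
      exact Subtype.ext (H.apply_apply_eq_zero y.1)
  have hbd : Function.Exact b d :=
    SnakeLemma.exact_δ'_right φN φM φP f g H f g H h₁ h₂ (LinearMap.ker φM).subtype
      (LinearMap.exact_subtype_ker_map _) _ (LinearMap.exact_subtype_ker_map _) _
      (LinearMap.exact_map_mkQ_range _) hg hf b rfl (Submodule.subtype_injective _)
  have hdG : Function.Exact d G :=
    SnakeLemma.exact_δ'_left φN φM φP f g H f g H h₁ h₂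
      _ (LinearMap.exact_subtype_ker_map _) _
      (LinearMap.exact_map_mkQ_range _) (LinearMap.range φM).mkQ (LinearMap.exact_map_mkQ_range _)
      hg hf G rfl (Submodule.mkQ_surjective _)
  have hGK : Function.Exact G K := by
    intro x
    obtain ⟨x, rfl⟩ := Submodule.mkQ_surjective _ x
    constructor
    · intro hx
      obtain ⟨y, hy⟩ : g x ∈ LinearMap.range φP := by
        simpa [K] using hx
      obtain ⟨z, rfl⟩ := hg y
      rw [← e₂, ← sub_eq_zero, ← map_sub] at hy
      obtain ⟨w, hw⟩ := (H _).1 hy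
      refine ⟨-Submodule.mkQ _ w, ?_⟩
      rw [map_neg]
      change -Submodule.mkQ _ (f w) = _
      rw [hw, map_sub, neg_sub, sub_eq_self]
      simp
    · rintro ⟨y, hy⟩
      obtain ⟨y, rfl⟩ := Submodule.mkQ_surjective _ y
      rw [← hy]
      change Submodule.mkQ _ (g (f y)) = 0
      rw [H.apply_apply_eq_zero, map_zero]
  have hK : Function.Surjective K := by
    intro x
    obtain ⟨x, rfl⟩ := Submodule.mkQ_surjective _ x
    obtain ⟨y, rfl⟩ := hg x
    exact ⟨Submodule.mkQ _ y, rfl⟩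
  -- The six-term exact sequence is cut at `b`, `d` and `G`, and consecutive pieces share the length
  -- of a range. Lengths may be infinite, so everything stays in additive form.
  have r₁ := localizedLength_eq_add_of_exact q ha b.surjective_rangeRestrict
    (by rw [LinearMap.exact_iff, LinearMap.ker_rangeRestrict, ← LinearMap.exact_iff]; exact hab)
  have r₂ := localizedLength_eq_ker_add_range q d
  have r₃ := localizedLength_eq_ker_add_range q G
  have r₄ := localizedLength_eq_add_of_exact q (Submodule.subtype_injective (LinearMap.ker K)) hK
    (LinearMap.exact_subtype_ker_map K)
  rw [hbd.linearMap_ker_eq] at r₂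
  rw [hdG.linearMap_ker_eq] at r₃
  rw [hGK.linearMap_ker_eq] at r₄
  rw [r₁, r₂, r₃, r₄]
  exact ⟨by ring, add_le_add_right le_self_add _⟩

/-- Both are complementary to the range of `φ` in `M`, whose finite length cancels. -/
theorem localizedLength_ker_eq_coker {φ : M →ₗ[A] M} (h : localizedLength q M ≠ ⊤) :
    localizedLength q (M ⧸ LinearMap.range φ) = localizedLength q (LinearMap.ker φ) := by
  have h₁ := localizedLength_eq_ker_add_range q φ
  have h₂ := localizedLength_eq_add_of_exact q (Submodule.subtype_injective (LinearMap.range φ))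
    (Submodule.mkQ_surjective _) (LinearMap.exact_subtype_mkQ _)
  have h₃ : localizedLength q (LinearMap.range φ) ≠ ⊤ := fun h' => h (by rw [h₁, h', add_top])
  rw [h₁, add_comm] at h₂
  exact (ENat.add_right_injective_of_ne_top h₃ h₂).symm

end LocalizedLength

/-! ### Lengths of cyclic modules, change of ring, finiteness. -/

section LocalizedLength

variable {A : Type*} [CommRing A] (q : PrimeSpectrum A)

theorem localizedLength_quotient_eq_length (J : Ideal A) :
    localizedLength q (A ⧸ J) = Module.length (Localization.AtPrime q.asIdeal)
      (Localization.AtPrime q.asIdeal ⧸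
        J.map (algebraMap A (Localization.AtPrime q.asIdeal))) := by
  rw [← Ideal.localized'_eq_map (Localization.AtPrime q.asIdeal) q.asIdeal.primeCompl J]
  exact (localizedLength_eq_length q (Submodule.toLocalizedQuotient'
    (Localization.AtPrime q.asIdeal) q.asIdeal.primeCompl
    (Algebra.linearMap A (Localization.AtPrime q.asIdeal)) J)).symm

theorem PrimeCycle.localLength_eq (p : PrimeSpectrum A) (x : A) :
    PrimeCycle.localLength p x q = localizedLength q (A ⧸ (p.asIdeal ⊔ Ideal.span {x})) :=
  (localizedLength_quotient_eq_length q _).symm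

theorem localizedLength_quotient_self : localizedLength q (A ⧸ q.asIdeal) = 1 := by
  rw [localizedLength_quotient_eq_length, IsLocalization.AtPrime.map_eq_maximalIdeal]
  have : IsSimpleModule (Localization.AtPrime q.asIdeal) (Localization.AtPrime q.asIdeal ⧸
      IsLocalRing.maximalIdeal (Localization.AtPrime q.asIdeal)) :=
    isSimpleModule_iff_isCoatom.2 (IsLocalRing.maximalIdeal.isMaximal _).out
  exact Module.length_eq_one _ _

theorem localizedLength_quotient_eq_zero {J : Ideal A} (h : ¬ J ≤ q.asIdeal) :
    localizedLength q (A ⧸ J) = 0 := by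
  obtain ⟨a, ha, haq⟩ := Set.not_subset.1 h
  refine (localizedLength_eq_zero_iff q).2 fun x => ⟨a, haq, ?_⟩
  obtain ⟨x, rfl⟩ := Ideal.Quotient.mk_surjective x
  exact Ideal.Quotient.eq_zero_iff_mem.2 (J.mul_mem_right _ ha)

/-- The local ring of `A/I` at `q` is a quotient of the local ring of `A` at the preimage of `q`,
and length over a quotient ring is length over the ring. -/
theorem localizedLength_comap_quotient {I : Ideal A} (q : PrimeSpectrum (A ⧸ I)) (M : Type*)
    [AddCommGroup M] [Module A M] [Module (A ⧸ I) M] [IsScalarTower A (A ⧸ I) M] :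
    localizedLength (PrimeSpectrum.comap (Ideal.Quotient.mk I) q) M = localizedLength q M := by
  set q' := PrimeSpectrum.comap (Ideal.Quotient.mk I) q
  let L := Localization.AtPrime q'.asIdeal
  let L' := Localization.AtPrime q.asIdeal
  have hS : Algebra.algebraMapSubmonoid (A ⧸ I) q'.asIdeal.primeCompl = q.asIdeal.primeCompl := by
    ext x
    constructor
    · rintro ⟨y, hy, rfl⟩
      exact hy
    · intro hx
      obtain ⟨y, rfl⟩ := Ideal.Quotient.mk_surjective x
      exact ⟨y, hx, rfl⟩
  let : Algebra L L' := (Localization.localRingHom q'.asIdeal q.asIdeal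
    (Ideal.Quotient.mk I) rfl).toAlgebra
  have htower : IsScalarTower A L L' := IsScalarTower.of_algebraMap_eq fun x => by
    exact (Localization.localRingHom_to_map q'.asIdeal q.asIdeal
      (Ideal.Quotient.mk I) rfl x).symm
  have hsurj : Function.Surjective (algebraMap L L') := by
    intro y
    obtain ⟨a, s, rfl⟩ := IsLocalization.exists_mk'_eq q.asIdeal.primeCompl y
    obtain ⟨a, rfl⟩ := Ideal.Quotient.mk_surjective a
    obtain ⟨s, hs⟩ := s
    obtain ⟨s, rfl⟩ := Ideal.Quotient.mk_surjective s
    exact ⟨IsLocalization.mk' L a ⟨s, hs⟩, Localization.localRingHom_mk' _ _ _ _ _ _⟩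
  let N := LocalizedModule q.asIdeal.primeCompl M
  let : Module L N := Module.compHom N (algebraMap L L')
  have t₁ : IsScalarTower L L' N := IsScalarTower.of_compHom L L' N
  have t₂ : IsScalarTower A L N := IsScalarTower.of_algebraMap_smul fun r x => by
    change algebraMap L L' (algebraMap A L r) • x = r • x
    rw [← IsScalarTower.algebraMap_apply, algebraMap_smul]
  have hloc : IsLocalizedModule (Algebra.algebraMapSubmonoid (A ⧸ I) q'.asIdeal.primeCompl)
      (LocalizedModule.mkLinearMap q.asIdeal.primeCompl M) := by
    rw [hS]
    infer_instance
  have hloc' := IsLocalizedModule.restrictScalars q'.asIdeal.primeCompl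
    (LocalizedModule.mkLinearMap q.asIdeal.primeCompl M)
  rw [← localizedLength_eq_length q'
    ((LocalizedModule.mkLinearMap q.asIdeal.primeCompl M).restrictScalars A)]
  exact Module.length_eq_of_surjective hsurj

variable [IsNoetherianRing A]

/-- A finite module has finite length at `q` if it vanishes at all primes strictly below `q`. -/
theorem localizedLength_ne_top {M : Type*} [AddCommGroup M] [Module A M] [hM : Module.Finite A M]
    (h : ∀ r < q, localizedLength r M = 0) : localizedLength q M ≠ ⊤ := by
  revert h
  induction hM using IsNoetherianRing.induction_on_isQuotientEquivQuotientPrime A with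
  | subsingleton N =>
    intro _
    simp [localizedLength_eq_zero_of_subsingleton]
  | quotient N p e =>
    intro h
    rw [e.localizedLength_eq]
    by_cases hp : p ≤ q
    · rcases hp.eq_or_lt with rfl | hlt
      · simp [localizedLength_quotient_self]
      · have := h p hlt
        rw [e.localizedLength_eq, localizedLength_quotient_self] at this
        exact absurd this one_ne_zero
    · simp [localizedLength_quotient_eq_zero q hp]
  | exact N₁ N₂ N₃ f g hf hg hfg h₁ h₃ =>
    intro h
    have h' r (hr : r < q) := (localizedLength_eq_add_of_exact r hf hg hfg).symm.trans (h r hr)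
    rw [localizedLength_eq_add_of_exact q hf hg hfg]
    exact ENat.add_ne_top_of_ne_top
      (h₁ fun r hr => (add_eq_zero.1 (h' r hr)).1) (h₃ fun r hr => (add_eq_zero.1 (h' r hr)).2)

end LocalizedLength

/-! ### Quotients of algebras by ideals. -/

section Quotients

variable {A B : Type*} [CommRing A] [CommRing B] [Algebra A B] (q : PrimeSpectrum A)

theorem localizedLength_quotient_comap {S : Type*} [CommRing S] [Algebra A S] [Algebra B S]
    [IsScalarTower A B S] (hsurj : Function.Surjective (algebraMap B S)) (J : Ideal S) :
    localizedLength q (S ⧸ J) = localizedLength q (B ⧸ J.comap (algebraMap B S)) := by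
  let f : B →ₗ[A] S ⧸ J := (Submodule.mkQ J).restrictScalars A ∘ₗ
    (IsScalarTower.toAlgHom A B S).toLinearMap
  have hf : Function.Surjective f := (Submodule.mkQ_surjective J).comp hsurj
  have hk : LinearMap.ker f = (J.comap (algebraMap B S)).restrictScalars A := by
    ext x
    exact Submodule.Quotient.mk_eq_zero J
  rw [← (f.quotKerEquivOfSurjective hf).localizedLength_eq q, hk]
  rfl

theorem localizedLength_coker_quotient (J : Ideal B) (u : B) :
    localizedLength q ((B ⧸ J) ⧸ LinearMap.range (Algebra.lsmul A A (B ⧸ J) u)) =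
      localizedLength q (B ⧸ (J ⊔ Ideal.span {u})) := by
  let F : B →ₗ[A] ((B ⧸ J) ⧸ LinearMap.range (Algebra.lsmul A A (B ⧸ J) u)) :=
    Submodule.mkQ _ ∘ₗ (Submodule.mkQ J).restrictScalars A
  have hF : Function.Surjective F :=
    (Submodule.mkQ_surjective _).comp (Submodule.mkQ_surjective J)
  have hk : LinearMap.ker F = (J ⊔ Ideal.span {u}).restrictScalars A := by
    ext x
    have h0 : x ∈ LinearMap.ker F ↔ Ideal.Quotient.mk J x ∈
        LinearMap.range (Algebra.lsmul A A (B ⧸ J) u) := by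
      rw [LinearMap.mem_ker]
      exact Submodule.Quotient.mk_eq_zero _
    rw [h0, Submodule.restrictScalars_mem]
    constructor
    · rintro ⟨y, hy⟩
      obtain ⟨y, rfl⟩ := Ideal.Quotient.mk_surjective y
      have hy' : Ideal.Quotient.mk J x = Ideal.Quotient.mk J (u * y) := hy.symm
      rw [Ideal.Quotient.eq] at hy'
      rw [← sub_add_cancel x (u * y)]
      exact add_mem (Ideal.mem_sup_left hy')
        (Ideal.mem_sup_right (Ideal.mul_mem_right _ _ (Ideal.mem_span_singleton_self u)))
    · intro hx
      obtain ⟨a, ha, b, hb, rfl⟩ := Submodule.mem_sup.1 hx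
      obtain ⟨w, rfl⟩ := Ideal.mem_span_singleton'.1 hb
      refine ⟨Ideal.Quotient.mk _ w, ?_⟩
      change Ideal.Quotient.mk _ (u * w) = _
      rw [map_add, Ideal.Quotient.eq_zero_iff_mem.2 ha, zero_add, mul_comm]
  rw [← (F.quotKerEquivOfSurjective hF).localizedLength_eq q, hk]
  rfl

end Quotients

/-! ### Dévissage: lengths at a prime expressed by generic lengths. -/

section Devissage

variable {A C : Type*} [CommRing A] [CommRing C] [Algebra A C]

theorem localizedLength_quotient_of_minimal {P Q : PrimeSpectrum C} [Decidable (Q = P)]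
    (h : Q ≤ P → Q = P) :
    localizedLength P (C ⧸ Q.asIdeal) = if Q = P then 1 else 0 := by
  split_ifs with hQ
  · rw [hQ, localizedLength_quotient_self]
  · exact localizedLength_quotient_eq_zero P fun hle => hQ (h hle)

variable [IsNoetherianRing C]

-- Both sides are additive in exact sequences, so `M = C/Q` with `J ≤ Q` suffices. By `hs` only the
-- term `P = Q` can survive, with factor `1`; if `Q` is not in `s`, both sides are zero, the left
-- one by `hJ`.
open Classical in
theorem localizedLength_eq_sum (q : PrimeSpectrum A) (J : Ideal C) (s : Finset (PrimeSpectrum C))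
    (hs : ∀ P ∈ s, ∀ Q : PrimeSpectrum C, J ≤ Q.asIdeal → Q ≤ P → Q = P)
    (hJ : ∀ Q : PrimeSpectrum C, J ≤ Q.asIdeal → Q ∉ s → localizedLength q (C ⧸ Q.asIdeal) = 0)
    {M : Type*} [AddCommGroup M] [Module C M] [hM : Module.Finite C M]
    (hJM : ∀ x ∈ J, ∀ m : M, x • m = 0) [Module A M] [IsScalarTower A C M] :
    localizedLength q M =
      ∑ P ∈ s, localizedLength P M * localizedLength q (C ⧸ P.asIdeal) := by
  revert hJM
  rename_i i₁ i₂
  revert i₁ i₂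
  induction hM using IsNoetherianRing.induction_on_isQuotientEquivQuotientPrime C with
  | subsingleton N =>
    intro _ _ _
    simp [localizedLength_eq_zero_of_subsingleton]
  | quotient N Q e =>
    intro _ _ hJN
    have hJQ : J ≤ Q.asIdeal := fun x hx => by
      have := hJN x hx (e.symm 1)
      rw [← map_smul, LinearEquiv.map_eq_zero_iff] at this
      rw [← Ideal.Quotient.eq_zero_iff_mem, ← mul_one (Ideal.Quotient.mk _ x)]
      exact this
    rw [(e.restrictScalars A).localizedLength_eq q, Finset.sum_congr rfl fun P hP => by
      rw [e.localizedLength_eq P, localizedLength_quotient_of_minimal (hs P hP Q hJQ)]]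
    by_cases hQ : Q ∈ s
    · simp [hQ]
    · simp [hQ, hJ Q hJQ]
  | exact N₁ N₂ N₃ f g hf hg hfg h₁ h₃ =>
    intro _ _ hJN
    let : Module A N₁ := Module.compHom N₁ (algebraMap A C)
    let : Module A N₃ := Module.compHom N₃ (algebraMap A C)
    have : IsScalarTower A C N₁ := IsScalarTower.of_compHom A C N₁
    have : IsScalarTower A C N₃ := IsScalarTower.of_compHom A C N₃
    have r₁ := h₁ fun x hx m => hf (by rw [map_smul, hJN x hx, map_zero])
    have r₃ := h₃ fun x hx m => by
      obtain ⟨m, rfl⟩ := hg m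
      rw [← map_smul, hJN x hx, map_zero]
    rw [localizedLength_eq_add_of_exact q (f := f.restrictScalars A) (g := g.restrictScalars A)
      hf hg hfg, r₁, r₃, ← Finset.sum_add_distrib]
    refine Finset.sum_congr rfl fun P _ => ?_
    rw [localizedLength_eq_add_of_exact P hf hg hfg, add_mul]

-- The difference of the lengths of cokernel and kernel of `u` is an Euler characteristic, additive
-- by the snake lemma, so `M = C/Q` suffices. For `Q ∈ s` the element `u` acts injectively; for the
-- other `Q` the length at `q` is finite and kernel and cokernel cancel. Finiteness of the kernel is
-- carried along to allow cancellation in `ℕ∞`.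
open Classical in
theorem localizedLength_coker_smul (q : PrimeSpectrum A) (J : Ideal C) (u : C)
    (s : Finset (PrimeSpectrum C)) (hu : ∀ P ∈ s, u ∉ P.asIdeal)
    (hs : ∀ P ∈ s, ∀ Q : PrimeSpectrum C, J ≤ Q.asIdeal → Q ≤ P → Q = P)
    (hJ : ∀ Q : PrimeSpectrum C, J ≤ Q.asIdeal → Q ∉ s → localizedLength q (C ⧸ Q.asIdeal) ≠ ⊤)
    {M : Type*} [AddCommGroup M] [Module C M] [hM : Module.Finite C M]
    (hJM : ∀ x ∈ J, ∀ m : M, x • m = 0) [Module A M] [IsScalarTower A C M] :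
    localizedLength q (LinearMap.ker (Algebra.lsmul A A M u)) ≠ ⊤ ∧
    localizedLength q (M ⧸ LinearMap.range (Algebra.lsmul A A M u)) =
      localizedLength q (LinearMap.ker (Algebra.lsmul A A M u)) +
      ∑ P ∈ s, localizedLength P M *
        localizedLength q (C ⧸ (P.asIdeal ⊔ Ideal.span {u})) := by
  revert hJM
  rename_i i₁ i₂
  revert i₁ i₂
  induction hM using IsNoetherianRing.induction_on_isQuotientEquivQuotientPrime C with
  | subsingleton N =>
    intro _ _ _
    simp [localizedLength_eq_zero_of_subsingleton]
  | quotient N Q e =>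
    intro _ _ hJN
    have hJQ : J ≤ Q.asIdeal := fun x hx => by
      have := hJN x hx (e.symm 1)
      rw [← map_smul, LinearEquiv.map_eq_zero_iff] at this
      rw [← Ideal.Quotient.eq_zero_iff_mem, ← mul_one (Ideal.Quotient.mk _ x)]
      exact this
    rw [Finset.sum_congr rfl fun P hP => by
      rw [e.localizedLength_eq P, localizedLength_quotient_of_minimal (hs P hP Q hJQ)]]
    by_cases hQ : Q ∈ s
    · have hker : LinearMap.ker (Algebra.lsmul A A N u) = ⊥ := by
        refine (Submodule.eq_bot_iff _).2 fun x hx => ?_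
        have hx' : u • x = 0 := hx
        have : u • e x = 0 := by rw [← map_smul, hx', map_zero]
        obtain ⟨y, hy⟩ := Ideal.Quotient.mk_surjective (e x)
        rw [← hy] at this
        have h2 : Ideal.Quotient.mk Q.asIdeal (u * y) = 0 := this
        rw [Ideal.Quotient.eq_zero_iff_mem] at h2
        rw [← e.map_eq_zero_iff, ← hy, Ideal.Quotient.eq_zero_iff_mem]
        exact (Q.isPrime.mem_or_mem h2).resolve_left (hu Q hQ)
      have hker' : localizedLength q (LinearMap.ker (Algebra.lsmul A A N u)) = 0 := by
        rw [hker]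
        exact localizedLength_eq_zero_of_subsingleton q
      refine ⟨by simp [hker'], ?_⟩
      rw [hker', zero_add]
      simp only [ite_mul, one_mul, zero_mul, Finset.sum_ite_eq, hQ, if_true]
      rw [← localizedLength_coker_quotient q Q.asIdeal u]
      refine LinearEquiv.localizedLength_eq q
        (Submodule.Quotient.equiv _ _ (e.restrictScalars A) ?_)
      ext x
      constructor
      · rintro ⟨_, ⟨y, rfl⟩, rfl⟩
        exact ⟨e y, (e.map_smul u y).symm⟩
      · rintro ⟨y, rfl⟩
        exact ⟨u • e.symm y, ⟨e.symm y, rfl⟩,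
          (e.map_smul u _).trans (congrArg (u • ·) (e.apply_symm_apply y))⟩
    · have hfin : localizedLength q N ≠ ⊤ := by
        rw [(e.restrictScalars A).localizedLength_eq q]
        exact hJ Q hJQ hQ
      refine ⟨fun h => hfin (top_le_iff.1 (h ▸ localizedLength_le_of_injective q
        (Submodule.subtype_injective _))), ?_⟩
      simp [hQ, localizedLength_ker_eq_coker q hfin]
  | exact N₁ N₂ N₃ f g hf hg hfg h₁ h₃ =>
    intro _ _ hJN
    let : Module A N₁ := Module.compHom N₁ (algebraMap A C)
    let : Module A N₃ := Module.compHom N₃ (algebraMap A C)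
    have : IsScalarTower A C N₁ := IsScalarTower.of_compHom A C N₁
    have : IsScalarTower A C N₃ := IsScalarTower.of_compHom A C N₃
    obtain ⟨t₁, r₁⟩ := h₁ fun x hx m => hf (by rw [map_smul, hJN x hx, map_zero])
    obtain ⟨t₃, r₃⟩ := h₃ fun x hx m => by
      obtain ⟨m, rfl⟩ := hg m
      rw [← map_smul, hJN x hx, map_zero]
    obtain ⟨hsnake, hle'⟩ := localizedLength_snake q (f := f.restrictScalars A) (g := g.restrictScalars A)
      hf hg hfg (Algebra.lsmul A A N₁ u) (Algebra.lsmul A A N₂ u) (Algebra.lsmul A A N₃ u)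
      (LinearMap.ext fun x => f.map_smul u x) (LinearMap.ext fun x => g.map_smul u x)
    have hle : localizedLength q (LinearMap.ker (Algebra.lsmul A A N₂ u)) ≠ ⊤ :=
      ne_top_of_le_ne_top (ENat.add_ne_top_of_ne_top t₁ t₃) hle'
    refine ⟨hle, ?_⟩
    have hsum : ∑ P ∈ s, localizedLength P N₂ *
          localizedLength q (C ⧸ (P.asIdeal ⊔ Ideal.span {u})) =
        ∑ P ∈ s, localizedLength P N₁ *
          localizedLength q (C ⧸ (P.asIdeal ⊔ Ideal.span {u})) +
        ∑ P ∈ s, localizedLength P N₃ *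
          localizedLength q (C ⧸ (P.asIdeal ⊔ Ideal.span {u})) := by
      rw [← Finset.sum_add_distrib]
      refine Finset.sum_congr rfl fun P _ => ?_
      rw [localizedLength_eq_add_of_exact P hf hg hfg, add_mul]
    rw [hsum]
    rw [r₁, r₃] at hsnake
    refine ENat.add_right_injective_of_ne_top (ENat.add_ne_top_of_ne_top t₁ t₃) ?_
    dsimp only
    rw [hsnake]
    ring

end Devissage

/-! ### Additivity of lengths in products. -/

section Additivity

variable {A B : Type*} [CommRing A] [CommRing B] [Algebra A B]

/-- Multiplication by `x`, a nonzerodivisor modulo `I`, gives an exact sequence `0 → B/(I, y) →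
B/(I, xy) → B/(I, x) → 0`. -/
theorem localizedLength_quotient_sup_mul (q : PrimeSpectrum A) (I : Ideal B) {x : B} (y : B)
    (hx : ∀ z, x * z ∈ I → z ∈ I) :
    localizedLength q (B ⧸ (I ⊔ Ideal.span {x * y})) =
      localizedLength q (B ⧸ (I ⊔ Ideal.span {x})) +
        localizedLength q (B ⧸ (I ⊔ Ideal.span {y})) := by
  have hle : I ⊔ Ideal.span {x * y} ≤ I ⊔ Ideal.span {x} :=
    sup_le_sup_left (Ideal.span_singleton_le_span_singleton.2 ⟨y, rfl⟩) I
  have hmul : I ⊔ Ideal.span {y} ≤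
      Submodule.comap (LinearMap.mulLeft B x) (I ⊔ Ideal.span {x * y}) := by
    refine sup_le (fun z hz => Ideal.mem_sup_left (I.mul_mem_left _ hz)) ?_
    rw [Ideal.span_singleton_le_iff_mem]
    exact Ideal.mem_sup_right (Ideal.mem_span_singleton_self _)
  let f : (B ⧸ (I ⊔ Ideal.span {y})) →ₗ[B] (B ⧸ (I ⊔ Ideal.span {x * y})) :=
    Submodule.mapQ _ _ (LinearMap.mulLeft B x) hmul
  let g : (B ⧸ (I ⊔ Ideal.span {x * y})) →ₗ[B] (B ⧸ (I ⊔ Ideal.span {x})) :=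
    Submodule.factor hle
  have hf : Function.Injective f := by
    refine (injective_iff_map_eq_zero f).2 fun z hz => ?_
    obtain ⟨z, rfl⟩ := Ideal.Quotient.mk_surjective z
    have hz' : x * z ∈ I ⊔ Ideal.span {x * y} := (Submodule.Quotient.mk_eq_zero _).1 hz
    obtain ⟨a, ha, b, hb, hab⟩ := Submodule.mem_sup.1 hz'
    obtain ⟨w, rfl⟩ := Ideal.mem_span_singleton'.1 hb
    refine Ideal.Quotient.eq_zero_iff_mem.2 ?_
    have h1 : z - w * y ∈ I := hx _ <| by
      rw [show x * (z - w * y) = a by rw [mul_sub, ← hab]; ring]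
      exact ha
    rw [← sub_add_cancel z (w * y)]
    exact add_mem (Ideal.mem_sup_left h1)
      (Ideal.mem_sup_right (Ideal.mul_mem_left _ _ (Ideal.mem_span_singleton_self y)))
  have hfg : Function.Exact f g := by
    intro z
    obtain ⟨z, rfl⟩ := Ideal.Quotient.mk_surjective z
    constructor
    · intro hz
      have hz' : z ∈ I ⊔ Ideal.span {x} := (Submodule.Quotient.mk_eq_zero _).1 hz
      obtain ⟨a, ha, b, hb, rfl⟩ := Submodule.mem_sup.1 hz'
      obtain ⟨w, rfl⟩ := Ideal.mem_span_singleton'.1 hb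
      refine ⟨Ideal.Quotient.mk _ w, ?_⟩
      change Ideal.Quotient.mk _ (x * w) = _
      rw [Ideal.Quotient.eq]
      refine Ideal.mem_sup_left ?_
      rw [show x * w - (a + w * x) = -a by ring]
      exact neg_mem ha
    · rintro ⟨w, hw⟩
      obtain ⟨w, rfl⟩ := Ideal.Quotient.mk_surjective w
      rw [← hw]
      change Ideal.Quotient.mk _ (x * w) = 0
      rw [Ideal.Quotient.eq_zero_iff_mem]
      exact Ideal.mem_sup_right (Ideal.mul_mem_right _ _ (Ideal.mem_span_singleton_self x))
  rw [localizedLength_eq_add_of_exact q (f := f.restrictScalars A) (g := g.restrictScalars A)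
    hf (Submodule.factor_surjective hle) hfg, add_comm]

theorem localizedLength_quotient_eq_zero_of_comap {q : PrimeSpectrum A} {J : Ideal B}
    (h : ¬ J.comap (algebraMap A B) ≤ q.asIdeal) : localizedLength q (B ⧸ J) = 0 := by
  obtain ⟨a, ha, haq⟩ := Set.not_subset.1 h
  refine (localizedLength_eq_zero_iff q).2 fun x => ⟨a, haq, ?_⟩
  obtain ⟨x, rfl⟩ := Ideal.Quotient.mk_surjective x
  rw [← algebraMap_smul B a]
  exact Ideal.Quotient.eq_zero_iff_mem.2 (J.mul_mem_right _ ha)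

end Additivity

/-! ### Orders of vanishing at primes of height one; uniformizers in a normal domain. -/

section Order

variable {B : Type*} [CommRing B]

/-- The order of vanishing of `x` at `P`. -/
noncomputable def primeOrder (P : PrimeSpectrum B) (x : B) : ℕ :=
  (localizedLength P (B ⧸ Ideal.span {x})).toNat

variable {P : PrimeSpectrum B}

theorem primeOrder_eq_zero {x : B} (hx : x ∉ P.asIdeal) : primeOrder P x = 0 := by
  rw [primeOrder, localizedLength_quotient_eq_zero, ENat.toNat_zero]
  rwa [Ideal.span_singleton_le_iff_mem]

variable [IsDomain B] [IsNoetherianRing B] (hP : IsAtom P)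
include hP

theorem localizedLength_quotient_span_ne_top {x : B} (hx : x ≠ 0) :
    localizedLength P (B ⧸ Ideal.span {x}) ≠ ⊤ := by
  refine localizedLength_ne_top P fun r hr => localizedLength_quotient_eq_zero r fun hle => hx ?_
  rw [hP.2 r hr, Ideal.span_singleton_le_iff_mem, PrimeSpectrum.asIdeal_bot] at hle
  exact hle

theorem primeOrder_eq_zero_iff {x : B} (hx : x ≠ 0) : primeOrder P x = 0 ↔ x ∉ P.asIdeal := by
  refine ⟨fun h hxP => ?_, primeOrder_eq_zero⟩
  rw [primeOrder, ENat.toNat_eq_zero] at h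
  rcases h with h | h
  · obtain ⟨a, ha, h⟩ := (localizedLength_eq_zero_iff P).1 h 1
    have h' : Ideal.Quotient.mk (Ideal.span {x}) (a * 1) = 0 := h
    rw [mul_one, Ideal.Quotient.eq_zero_iff_mem] at h'
    exact ha ((Ideal.span_singleton_le_iff_mem _).2 hxP h')
  · exact localizedLength_quotient_span_ne_top hP hx h

theorem primeOrder_mul {x y : B} (hx : x ≠ 0) (hy : y ≠ 0) :
    primeOrder P (x * y) = primeOrder P x + primeOrder P y := by
  have := localizedLength_quotient_sup_mul (A := B) P (⊥ : Ideal B) (x := x) y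
    fun z hz => (mul_eq_zero.1 hz).resolve_left hx
  rw [bot_sup_eq, bot_sup_eq, bot_sup_eq] at this
  rw [primeOrder, this, ENat.toNat_add (localizedLength_quotient_span_ne_top hP hx)
    (localizedLength_quotient_span_ne_top hP hy), primeOrder, primeOrder]

theorem primeOrder_pow {x : B} (hx : x ≠ 0) (n : ℕ) :
    primeOrder P (x ^ n) = n * primeOrder P x := by
  induction n with
  | zero =>
    rw [pow_zero, zero_mul, primeOrder_eq_zero ((Ideal.ne_top_iff_one _).1 P.isPrime.ne_top)]
  | succ n ih => rw [pow_succ, primeOrder_mul hP (pow_ne_zero n hx) hx, ih]; ring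

variable [IsIntegrallyClosed B]

/-- The localization at an atom is a normal noetherian local domain whose only nonzero prime is the
maximal ideal, which is therefore principal. A generator can be taken from `B` because denominators
are units. -/
theorem exists_map_eq_span_of_isAtom : ∃ π : B, π ≠ 0 ∧
    P.asIdeal.map (algebraMap B (Localization.AtPrime P.asIdeal)) =
      (Ideal.span {π}).map (algebraMap B (Localization.AtPrime P.asIdeal)) := by
  let L := Localization.AtPrime P.asIdeal
  have : IsIntegrallyClosed L :=
    isIntegrallyClosed_of_isLocalization L P.asIdeal.primeCompl P.asIdeal.primeCompl_le_nonZeroDivisors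
  have : IsNoetherianRing L := IsLocalization.isNoetherianRing P.asIdeal.primeCompl L inferInstance
  have hprime : ∀ Q : Ideal L, Q ≠ ⊥ → Q.IsPrime → Q = IsLocalRing.maximalIdeal L := by
    intro Q hQ hQp
    have hQc : (Q.comap (algebraMap B L)).IsPrime := hQp.comap _
    have hle : (⟨Q.comap (algebraMap B L), hQc⟩ : PrimeSpectrum B) ≤ P := by
      have := Ideal.comap_mono (f := algebraMap B L) (IsLocalRing.le_maximalIdeal hQp.ne_top)
      rw [show (IsLocalRing.maximalIdeal L).comap (algebraMap B L) = P.asIdeal from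
        IsLocalization.AtPrime.under_maximalIdeal L P.asIdeal] at this
      exact this
    have hmap := IsLocalization.map_under P.asIdeal.primeCompl L Q
    rcases hle.eq_or_lt with h | h
    · rw [← hmap, ← IsLocalization.AtPrime.map_eq_maximalIdeal P.asIdeal L]
      exact congrArg (Ideal.map (algebraMap B L)) congr(($h).asIdeal)
    · have h0 : Ideal.under B Q = ⊥ := congr(($(hP.2 _ h)).asIdeal)
      rw [h0, Ideal.map_bot] at hmap
      exact absurd hmap.symm hQ
  have htfae := (tfae_of_isNoetherianRing_of_isLocalRing_of_isDomain L).out 3 4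
  obtain ⟨⟨y, hy⟩⟩ := htfae.1 ⟨inferInstance, hprime⟩
  obtain ⟨π, s, rfl⟩ := IsLocalization.exists_mk'_eq P.asIdeal.primeCompl y
  have hspan : IsLocalRing.maximalIdeal L = (Ideal.span {π}).map (algebraMap B L) := by
    rw [hy, Ideal.map_span, Set.image_singleton]
    refine Ideal.span_singleton_eq_span_singleton.2 ?_
    obtain ⟨w, hw⟩ := IsLocalization.map_units L s
    exact ⟨w, by rw [hw, IsLocalization.mk'_spec]⟩
  refine ⟨π, ?_, by rw [IsLocalization.AtPrime.map_eq_maximalIdeal P.asIdeal L, hspan]⟩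
  rintro rfl
  rw [Set.singleton_zero, Ideal.span_zero, Ideal.map_bot] at hspan
  refine hP.1 (PrimeSpectrum.ext ?_)
  rw [← IsLocalization.AtPrime.under_maximalIdeal L P.asIdeal, hspan, PrimeSpectrum.asIdeal_bot]
  exact (RingHom.injective_iff_ker_eq_bot _).1
    (IsLocalization.injective L P.asIdeal.primeCompl_le_nonZeroDivisors)

/-- Up to units at `P`, every nonzero element is a power of a fixed element of order one. -/
theorem exists_primeOrder_eq_one : ∃ π : B, π ≠ 0 ∧ primeOrder P π = 1 ∧
    ∀ x ≠ 0, ∃ c ∉ P.asIdeal, ∃ d ∉ P.asIdeal, d * x = c * π ^ primeOrder P x := by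
  obtain ⟨π, hπ, hmap⟩ := exists_map_eq_span_of_isAtom hP
  have h1 : primeOrder P π = 1 := by
    rw [primeOrder, localizedLength_quotient_eq_length, ← hmap,
      ← localizedLength_quotient_eq_length, localizedLength_quotient_self, ENat.toNat_one]
  refine ⟨π, hπ, h1, fun x hx => ?_⟩
  have hone : (1 : B) ∉ P.asIdeal := (Ideal.ne_top_iff_one _).1 P.isPrime.ne_top
  generalize hn : primeOrder P x = n
  induction n generalizing x with
  | zero =>
    exact ⟨x, (primeOrder_eq_zero_iff hP hx).1 hn, 1, hone, by ring⟩
  | succ n ih =>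
    have hxP : x ∈ P.asIdeal := by
      by_contra h
      rw [primeOrder_eq_zero h] at hn
      omega
    have hx' := Ideal.mem_map_of_mem (algebraMap B (Localization.AtPrime P.asIdeal)) hxP
    rw [hmap, IsLocalization.algebraMap_mem_map_algebraMap_iff P.asIdeal.primeCompl] at hx'
    obtain ⟨d, hd, hdx⟩ := hx'
    obtain ⟨y, hy⟩ := Ideal.mem_span_singleton'.1 hdx
    have hd0 : d ≠ 0 := fun h => hd (h ▸ P.asIdeal.zero_mem)
    have hy0 : y ≠ 0 := by
      rintro rfl
      rw [zero_mul] at hy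
      exact mul_ne_zero hd0 hx hy.symm
    have hord := primeOrder_mul hP hd0 hx
    rw [← hy, primeOrder_mul hP hy0 hπ, primeOrder_eq_zero hd, hn, h1] at hord
    obtain ⟨c, hc, e, he, h⟩ := ih y hy0 (by omega)
    exact ⟨c, hc, e * d, P.isPrime.mul_notMem he hd, by
      rw [mul_assoc, ← hy, ← mul_assoc, h]; ring⟩

/-- Elements of equal order differ by a unit at `P`, which is written here as the fraction `c / d`.
-/
theorem exists_mul_eq_mul_of_primeOrder_eq {x y : B} (hx : x ≠ 0) (hy : y ≠ 0)
    (h : primeOrder P x = primeOrder P y) :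
    ∃ c ∉ P.asIdeal, ∃ d ∉ P.asIdeal, d * x = c * y := by
  obtain ⟨π, hπ, -, hπ'⟩ := exists_primeOrder_eq_one hP
  obtain ⟨c, hc, d, hd, h₁⟩ := hπ' x hx
  obtain ⟨c', hc', d', hd', h₂⟩ := hπ' y hy
  refine ⟨c * d', P.isPrime.mul_notMem hc hd', c' * d, P.isPrime.mul_notMem hc' hd, ?_⟩
  rw [mul_assoc, h₁, h, mul_assoc c d', h₂]
  ring

/-- An element of order one at `P` that avoids finitely many other primes of height one. -/
theorem exists_primeOrder_eq_one_notMem (s : Finset (PrimeSpectrum B)) (hs : ∀ Q ∈ s, IsAtom Q) :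
    ∃ x : B, x ≠ 0 ∧ primeOrder P x = 1 ∧ ∀ Q ∈ s, Q ≠ P → x ∉ Q.asIdeal := by
  classical
  obtain ⟨π, hπ, hπ1, hπ'⟩ := exists_primeOrder_eq_one hP
  have hπP : π ∈ P.asIdeal := by
    by_contra h
    rw [primeOrder_eq_zero h] at hπ1
    omega
  -- `J` consists of zero and the elements of order at least two at `P`.
  let J : Ideal B := ((Ideal.span {π ^ 2}).map
    (algebraMap B (Localization.AtPrime P.asIdeal))).comap
    (algebraMap B (Localization.AtPrime P.asIdeal))
  have hJ (x : B) : x ∈ J ↔ ∃ d ∉ P.asIdeal, ∃ y, y * π ^ 2 = d * x := by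
    rw [Ideal.mem_comap,
      IsLocalization.algebraMap_mem_map_algebraMap_iff P.asIdeal.primeCompl]
    simp only [Ideal.mem_span_singleton']
    rfl
  -- Prime avoidance tolerates the ideal `J`, which need not be prime, at the index `P`.
  have hnot : ¬ (P.asIdeal : Set B) ⊆ ⋃ Q ∈ (↑(insert P s) : Set (PrimeSpectrum B)),
      ((if Q = P then J else Q.asIdeal : Ideal B) : Set B) := by
    rw [Ideal.subset_union_prime P P fun Q _ hQ _ => by rw [if_neg hQ]; exact Q.isPrime]
    rintro ⟨Q, hQ, hle⟩
    split_ifs at hle with hQP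
    · obtain ⟨d, hd, y, hy⟩ := (hJ π).1 (hle hπP)
      refine hd ?_
      rw [← mul_right_cancel₀ hπ (show y * π * π = d * π by rw [← hy]; ring)]
      exact P.asIdeal.mul_mem_left _ hπP
    · have hQs : Q ∈ s := (Finset.mem_insert.1 hQ).resolve_left hQP
      have hle' : P ≤ Q := hle
      rcases hle'.eq_or_lt with h | h
      · exact hQP h.symm
      · exact hP.1 ((hs Q hQs).2 P h)
  obtain ⟨x, hxP, hx⟩ := Set.not_subset.1 hnot
  simp only [Set.mem_iUnion, not_exists] at hx
  have hxJ : x ∉ J := by simpa using hx P (by simp)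
  have hx0 : x ≠ 0 := fun h => hxJ (h ▸ J.zero_mem)
  refine ⟨x, hx0, ?_, fun Q hQ hQP => by simpa [hQP] using hx Q (by simp [hQ])⟩
  obtain ⟨c, hc, d, hd, h⟩ := hπ' x hx0
  have h0 : primeOrder P x ≠ 0 := fun h => (primeOrder_eq_zero_iff hP hx0).1 h hxP
  by_contra h1
  -- The order is neither `0` nor `1` here, so the truncated subtraction is exact and `x` would lie
  -- in `J`.
  refine hxJ ((hJ x).2 ⟨d, hd, c * π ^ (primeOrder P x - 2), ?_⟩)
  rw [h, mul_assoc, ← pow_add]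
  congr 2
  omega

end Order

/-! ### Symmetry of kernel and cokernel, that is, of Koszul homology. -/

section Symmetry

variable {A B : Type*} [CommRing A] [CommRing B] [Algebra A B]

theorem localizedLength_coker_symm (q : PrimeSpectrum A) (u v : B) :
    localizedLength q
      ((B ⧸ Ideal.span {v}) ⧸ LinearMap.range (Algebra.lsmul A A (B ⧸ Ideal.span {v}) u)) =
    localizedLength q
      ((B ⧸ Ideal.span {u}) ⧸ LinearMap.range (Algebra.lsmul A A (B ⧸ Ideal.span {u}) v)) := by
  rw [localizedLength_coker_quotient, localizedLength_coker_quotient, sup_comm]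

/-- Both kernels are quotients of the module `W` of pairs `(x, y)` with `u x = v y`, by the same
submodule, the multiples of `(v, u)`. -/
theorem localizedLength_ker_symm [IsDomain B] (q : PrimeSpectrum A) {u v : B} (hu : u ≠ 0)
    (hv : v ≠ 0) :
    localizedLength q (LinearMap.ker (Algebra.lsmul A A (B ⧸ Ideal.span {v}) u)) =
    localizedLength q (LinearMap.ker (Algebra.lsmul A A (B ⧸ Ideal.span {u}) v)) := by
  let W : Submodule A (B × B) := LinearMap.ker
    ((LinearMap.mulLeft A u) ∘ₗ LinearMap.fst A B B - (LinearMap.mulLeft A v) ∘ₗ LinearMap.snd A B B)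
  have hW (x : W) : u * x.1.1 = v * x.1.2 := sub_eq_zero.1 x.2
  let F : W →ₗ[A] LinearMap.ker (Algebra.lsmul A A (B ⧸ Ideal.span {v}) u) :=
    LinearMap.codRestrict _ ((Submodule.mkQ (Ideal.span {v})).restrictScalars A ∘ₗ
      LinearMap.fst A B B ∘ₗ W.subtype) fun x => by
        change Ideal.Quotient.mk (Ideal.span {v}) (u * x.1.1) = 0
        rw [hW, Ideal.Quotient.eq_zero_iff_mem]
        exact Ideal.mul_mem_right _ _ (Ideal.mem_span_singleton_self v)
  let G : W →ₗ[A] LinearMap.ker (Algebra.lsmul A A (B ⧸ Ideal.span {u}) v) :=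
    LinearMap.codRestrict _ ((Submodule.mkQ (Ideal.span {u})).restrictScalars A ∘ₗ
      LinearMap.snd A B B ∘ₗ W.subtype) fun x => by
        change Ideal.Quotient.mk (Ideal.span {u}) (v * x.1.2) = 0
        rw [← hW, Ideal.Quotient.eq_zero_iff_mem]
        exact Ideal.mul_mem_right _ _ (Ideal.mem_span_singleton_self u)
  have hF : Function.Surjective F := by
    rintro ⟨x, hx⟩
    obtain ⟨x, rfl⟩ := Ideal.Quotient.mk_surjective x
    have hx' : Ideal.Quotient.mk (Ideal.span {v}) (u * x) = 0 := hx
    rw [Ideal.Quotient.eq_zero_iff_mem, Ideal.mem_span_singleton'] at hx'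
    obtain ⟨y, hy⟩ := hx'
    exact ⟨⟨(x, y), sub_eq_zero.2 (by simp [← hy, mul_comm])⟩, rfl⟩
  have hG : Function.Surjective G := by
    rintro ⟨x, hx⟩
    obtain ⟨x, rfl⟩ := Ideal.Quotient.mk_surjective x
    have hx' : Ideal.Quotient.mk (Ideal.span {u}) (v * x) = 0 := hx
    rw [Ideal.Quotient.eq_zero_iff_mem, Ideal.mem_span_singleton'] at hx'
    obtain ⟨y, hy⟩ := hx'
    exact ⟨⟨(y, x), sub_eq_zero.2 (by simp [← hy, mul_comm])⟩, rfl⟩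
  have hk : LinearMap.ker F = LinearMap.ker G := by
    ext x
    have h1 : x ∈ LinearMap.ker F ↔ Ideal.Quotient.mk (Ideal.span {v}) x.1.1 = 0 :=
      Subtype.ext_iff
    have h2 : x ∈ LinearMap.ker G ↔ Ideal.Quotient.mk (Ideal.span {u}) x.1.2 = 0 :=
      Subtype.ext_iff
    rw [h1, h2, Ideal.Quotient.eq_zero_iff_mem, Ideal.Quotient.eq_zero_iff_mem,
      Ideal.mem_span_singleton', Ideal.mem_span_singleton']
    constructor
    · rintro ⟨a, ha⟩
      refine ⟨a, mul_left_cancel₀ hv ?_⟩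
      rw [← hW, ← ha]
      ring
    · rintro ⟨a, ha⟩
      refine ⟨a, mul_left_cancel₀ hu ?_⟩
      rw [hW, ← ha]
      ring
  rw [← (F.quotKerEquivOfSurjective hF).localizedLength_eq q, hk,
    (G.quotKerEquivOfSurjective hG).localizedLength_eq q]

end Symmetry

/-! ### Divisorial primes of a finite extension. -/

section Dimension

theorem PrimeSpectrum.comap_algebraMap_lt {A B : Type*} [CommRing A] [CommRing B] [Algebra A B]
    [Module.Finite A B] {P Q : PrimeSpectrum B} (h : P < Q) :
    PrimeSpectrum.comap (algebraMap A B) P < PrimeSpectrum.comap (algebraMap A B) Q :=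
  Ideal.IsIntegral.comap_lt_comap (R := A) (I := P.asIdeal) (J := Q.asIdeal) h

variable {A : Type*} [CommRing A] [IsNoetherianRing A] (δ : DimensionFunction A)

theorem DimensionFunction.dim_le_of_le {p q : PrimeSpectrum A} (h : p ≤ q) :
    δ.dim q ≤ δ.dim p := by
  rcases h.eq_or_lt with rfl | h
  · rfl
  · exact (δ.dim_lt_of_lt q p h).le

theorem DimensionFunction.eq_of_le_of_dim_eq {p q : PrimeSpectrum A} (h : p ≤ q)
    (hd : δ.dim p = δ.dim q) : p = q :=
  h.eq_or_lt.resolve_right fun h => by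
    have := δ.dim_lt_of_lt q p h
    omega

variable {B : Type*} [CommRing B] [IsDomain B] [Algebra A B]

/-- A prime of `B` that lies over a prime whose dimension is one less than the dimension of the
contraction of the zero ideal. -/
def DimensionFunction.IsDivisorial (P : PrimeSpectrum B) : Prop :=
  δ.dim (PrimeSpectrum.comap (algebraMap A B) ⊥) =
    δ.dim (PrimeSpectrum.comap (algebraMap A B) P) + 1

variable [Module.Finite A B]

variable {δ} {P : PrimeSpectrum B}

/-- By incomparability every strict inclusion of primes of `B` contracts to a strict one and costs
at least one dimension. Only one is available between `⊥` and `P`. -/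
theorem DimensionFunction.IsDivisorial.isAtom (hP : δ.IsDivisorial P) : IsAtom P := by
  rw [DimensionFunction.IsDivisorial] at hP
  refine ⟨fun h => ?_, fun Q hQ => ?_⟩
  · rw [h] at hP
    omega
  · by_contra hne
    have h1 := δ.dim_lt_of_lt _ _ (PrimeSpectrum.comap_algebraMap_lt (A := A) hQ)
    have h2 := δ.dim_lt_of_lt _ _ (PrimeSpectrum.comap_algebraMap_lt (A := A)
      (bot_lt_iff_ne_bot.2 hne))
    omega

theorem isDivisorial_of_le {r : PrimeSpectrum A}
    (hr : δ.dim (PrimeSpectrum.comap (algebraMap A B) ⊥) ≤ δ.dim r + 1)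
    (hP : P ≠ ⊥) (h : PrimeSpectrum.comap (algebraMap A B) P ≤ r) : δ.IsDivisorial P := by
  have h1 := δ.dim_le_of_le h
  have h2 := δ.dim_lt_of_lt _ _ (PrimeSpectrum.comap_algebraMap_lt (A := A)
      (bot_lt_iff_ne_bot.2 hP))
  rw [DimensionFunction.IsDivisorial]
  omega

theorem finite_isDivisorial_mem {x : B} (hx : x ≠ 0) :
    {P : PrimeSpectrum B | δ.IsDivisorial P ∧ x ∈ P.asIdeal}.Finite := by
  have : IsNoetherianRing B := IsNoetherianRing.of_finite A B
  refine Set.Finite.of_finite_image (f := PrimeSpectrum.asIdeal)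
    (((Ideal.span {x}).finite_minimalPrimes_of_isNoetherianRing B).subset ?_)
    (fun a _ b _ h => PrimeSpectrum.ext h)
  rintro _ ⟨P, ⟨hP, hxP⟩, rfl⟩
  refine ⟨⟨P.isPrime, (Ideal.span_singleton_le_iff_mem _).2 hxP⟩, fun Q hQ hQP => ?_⟩
  let Q' : PrimeSpectrum B := ⟨Q, hQ.1⟩
  have hle : Q' ≤ P := hQP
  rcases hle.eq_or_lt with h | h
  · exact h.symm.le
  · have h0 : Q = ⊥ := congr(($(hP.isAtom.2 Q' h)).asIdeal)
    have := (Ideal.span_singleton_le_iff_mem _).1 hQ.2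
    rw [h0] at this
    exact absurd this hx

variable {q : PrimeSpectrum A}

/-- If the module were nonzero at some `r < q`, a prime over `r` would contain `(P, x)`, hence be
strictly larger than `P`. Then `dim r ≤ dim q`, which is impossible. -/
theorem localizedLength_residue_ne_top
    (hq : δ.dim (PrimeSpectrum.comap (algebraMap A B) ⊥) = δ.dim q + 2)
    (hP : δ.IsDivisorial P) {x : B} (hx : x ∉ P.asIdeal) :
    localizedLength q (B ⧸ (P.asIdeal ⊔ Ideal.span {x})) ≠ ⊤ := by
  refine localizedLength_ne_top q fun r hr => localizedLength_quotient_eq_zero_of_comap fun hle => ?_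
  obtain ⟨Q, hQ, hQp, hQr⟩ := Ideal.exists_ideal_over_prime_of_isIntegral r.asIdeal _ hle
  have hlt : P < ⟨Q, hQp⟩ := by
    refine lt_of_le_of_ne (le_sup_left.trans hQ) ?_
    rintro rfl
    exact hx (hQ (Ideal.mem_sup_right (Ideal.mem_span_singleton_self x)))
  have h1 := PrimeSpectrum.comap_algebraMap_lt (A := A) hlt
  have h2 : PrimeSpectrum.comap (algebraMap A B) ⟨Q, hQp⟩ = r := PrimeSpectrum.ext hQr
  have h3 := δ.dim_lt_of_lt _ _ h1
  have h4 := δ.dim_lt_of_lt _ _ hr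
  rw [h2] at h3
  rw [DimensionFunction.IsDivisorial] at hP
  omega

/-- This is what makes the primes that are neither zero nor divisorial invisible to the Euler
characteristic in `localizedLength_coker_smul`. -/
theorem localizedLength_quotient_prime_ne_top
    (hq : δ.dim (PrimeSpectrum.comap (algebraMap A B) ⊥) = δ.dim q + 2)
    (hP : P ≠ ⊥) (hP' : ¬ δ.IsDivisorial P) : localizedLength q (B ⧸ P.asIdeal) ≠ ⊤ :=
  localizedLength_ne_top q fun r hr => localizedLength_quotient_eq_zero_of_comap fun hle =>
    hP' (isDivisorial_of_le (by have := δ.dim_lt_of_lt _ _ hr; omega) hP hle)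

end Dimension

/-! ### Tame symbols and the sum of their orders. -/

section TameSymbol

variable {A B : Type*} [CommRing A] [CommRing B] [Algebra A B]

/-- The length at `q` of `B/(P, x)`. -/
noncomputable def residueOrder (q : PrimeSpectrum A) (P : PrimeSpectrum B) (x : B) : ℕ :=
  (localizedLength q (B ⧸ (P.asIdeal ⊔ Ideal.span {x}))).toNat

/-- The fraction `c / d` of the residue field at `P` is, up to sign, the tame symbol of `u`
and `v`. -/
def IsTameSymbol (P : PrimeSpectrum B) (u v c d : B) : Prop :=
  c ∉ P.asIdeal ∧ d ∉ P.asIdeal ∧ d * u ^ primeOrder P v = c * v ^ primeOrder P u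

/-- Numerator and denominator of a tame symbol. -/
noncomputable def tameSymbol (P : PrimeSpectrum B) (u v : B) : B × B :=
  Classical.epsilon fun c => IsTameSymbol P u v c.1 c.2

/-- The order at `q` of the norm of the tame symbol of `u` and `v` at `P`. -/
noncomputable def tameOrder (q : PrimeSpectrum A) (P : PrimeSpectrum B) (u v : B) : ℤ :=
  residueOrder q P (tameSymbol P u v).1 - residueOrder q P (tameSymbol P u v).2

theorem residueOrder_one (q : PrimeSpectrum A) (P : PrimeSpectrum B) :
    residueOrder q P 1 = 0 := by
  have : Subsingleton (B ⧸ (P.asIdeal ⊔ Ideal.span {(1 : B)})) :=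
    Ideal.Quotient.subsingleton_iff.2 (by rw [Ideal.span_singleton_one, sup_top_eq])
  rw [residueOrder, localizedLength_eq_zero_of_subsingleton, ENat.toNat_zero]

variable [IsDomain B] [IsNoetherianRing B] [IsIntegrallyClosed B] {P : PrimeSpectrum B}

theorem isTameSymbol_tameSymbol (hP : IsAtom P) {u v : B} (hu : u ≠ 0) (hv : v ≠ 0) :
    IsTameSymbol P u v (tameSymbol P u v).1 (tameSymbol P u v).2 := by
  obtain ⟨c, hc, d, hd, h⟩ := exists_mul_eq_mul_of_primeOrder_eq hP
    (pow_ne_zero (primeOrder P v) hu) (pow_ne_zero (primeOrder P u) hv)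
    (by rw [primeOrder_pow hP hu, primeOrder_pow hP hv, mul_comm])
  exact Classical.epsilon_spec (p := fun c : B × B => IsTameSymbol P u v c.1 c.2)
    ⟨(c, d), hc, hd, h⟩

variable [IsNoetherianRing A] [Module.Finite A B] {δ : DimensionFunction A} {q : PrimeSpectrum A}
  (hq : δ.dim (PrimeSpectrum.comap (algebraMap A B) ⊥) = δ.dim q + 2)
include hq

omit [IsNoetherianRing B] [IsIntegrallyClosed B] in
theorem residueOrder_mul (hP : δ.IsDivisorial P) {x y : B} (hx : x ∉ P.asIdeal)
    (hy : y ∉ P.asIdeal) :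
    residueOrder q P (x * y) = residueOrder q P x + residueOrder q P y := by
  rw [residueOrder, localizedLength_quotient_sup_mul q P.asIdeal y
    fun z hz => (P.isPrime.mem_or_mem hz).resolve_left hx,
    ENat.toNat_add (localizedLength_residue_ne_top hq hP hx)
      (localizedLength_residue_ne_top hq hP hy), residueOrder, residueOrder]

omit [IsNoetherianRing B] [IsIntegrallyClosed B] in
theorem residueOrder_pow (hP : δ.IsDivisorial P) {x : B} (hx : x ∉ P.asIdeal) (n : ℕ) :
    residueOrder q P (x ^ n) = n * residueOrder q P x := by
  induction n with
  | zero => rw [pow_zero, residueOrder_one, zero_mul]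
  | succ n ih =>
    rw [pow_succ, residueOrder_mul hq hP (fun h => hx (P.isPrime.mem_of_pow_mem n h)) hx, ih]
    ring

/-- Two fractions representing the tame symbol agree after cross multiplication, already in the
domain `B`, and the residue order is additive. So the arbitrary choice in `tameSymbol` is
immaterial. -/
theorem tameOrder_eq (hP : δ.IsDivisorial P) {u v c d : B} (hu : u ≠ 0) (hv : v ≠ 0)
    (h : IsTameSymbol P u v c d) :
    tameOrder q P u v = residueOrder q P c - residueOrder q P d := by
  obtain ⟨hc, hd, hcd⟩ := h
  obtain ⟨hc', hd', hcd'⟩ := isTameSymbol_tameSymbol hP.isAtom hu hv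
  have key : (tameSymbol P u v).1 * d = c * (tameSymbol P u v).2 := by
    refine mul_right_cancel₀ (mul_ne_zero (pow_ne_zero (primeOrder P v) hu)
      (pow_ne_zero (primeOrder P u) hv)) ?_
    linear_combination (tameSymbol P u v).1 * v ^ primeOrder P u * hcd -
      c * v ^ primeOrder P u * hcd'
  have := congrArg (residueOrder q P) key
  rw [residueOrder_mul hq hP hc' hd, residueOrder_mul hq hP hc hd'] at this
  rw [tameOrder]
  omega

theorem tameOrder_mul_left (hP : δ.IsDivisorial P) {u u' v : B} (hu : u ≠ 0) (hu' : u' ≠ 0)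
    (hv : v ≠ 0) : tameOrder q P (u * u') v = tameOrder q P u v + tameOrder q P u' v := by
  obtain ⟨hc, hd, h⟩ := isTameSymbol_tameSymbol hP.isAtom hu hv
  obtain ⟨hc', hd', h'⟩ := isTameSymbol_tameSymbol hP.isAtom hu' hv
  rw [tameOrder_eq hq hP (mul_ne_zero hu hu') hv
    ⟨P.isPrime.mul_notMem hc hc', P.isPrime.mul_notMem hd hd', by
      rw [primeOrder_mul hP.isAtom hu hu', mul_pow, pow_add]
      linear_combination (tameSymbol P u' v).2 * u' ^ primeOrder P v * h +
        (tameSymbol P u v).1 * v ^ primeOrder P u * h'⟩,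
    residueOrder_mul hq hP hc hc', residueOrder_mul hq hP hd hd', tameOrder, tameOrder]
  push_cast
  ring

theorem tameOrder_swap (hP : δ.IsDivisorial P) {u v : B} (hu : u ≠ 0) (hv : v ≠ 0) :
    tameOrder q P v u = -tameOrder q P u v := by
  obtain ⟨hc, hd, h⟩ := isTameSymbol_tameSymbol hP.isAtom hu hv
  rw [tameOrder_eq hq hP hv hu ⟨hd, hc, h.symm⟩, tameOrder]
  ring

/-- If `v` is a unit at `P` the symbol is `1 / v ^ ord(u)`; if `u` is one, it is `u ^ ord(v) / 1`.
-/
theorem tameOrder_eq_sub (hP : δ.IsDivisorial P) {u v : B} (hu : u ≠ 0) (hv : v ≠ 0)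
    (h : u ∈ P.asIdeal → v ∉ P.asIdeal) :
    tameOrder q P u v = ((primeOrder P v * residueOrder q P u : ℕ) : ℤ) -
      ((primeOrder P u * residueOrder q P v : ℕ) : ℤ) := by
  have hone : (1 : B) ∉ P.asIdeal := (Ideal.ne_top_iff_one _).1 P.isPrime.ne_top
  by_cases huP : u ∈ P.asIdeal
  · have hvP := h huP
    have h0 := primeOrder_eq_zero hvP
    rw [tameOrder_eq hq hP hu hv ⟨hone, fun h => hvP (P.isPrime.mem_of_pow_mem (primeOrder P u) h),
      by rw [h0]; ring⟩, residueOrder_one, residueOrder_pow hq hP hvP, h0, zero_mul]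
  · have h0 := primeOrder_eq_zero huP
    rw [tameOrder_eq hq hP hu hv ⟨fun h => huP (P.isPrime.mem_of_pow_mem (primeOrder P v) h), hone,
      by rw [h0]; ring⟩, residueOrder_one, residueOrder_pow hq hP huP, h0, zero_mul]

theorem tameOrder_eq_zero (hP : δ.IsDivisorial P) {u v : B} (hu : u ≠ 0) (hv : v ≠ 0)
    (h : u * v ∉ P.asIdeal) : tameOrder q P u v = 0 := by
  have huP : u ∉ P.asIdeal := fun h' => h (P.asIdeal.mul_mem_right _ h')
  have hvP : v ∉ P.asIdeal := fun h' => h (P.asIdeal.mul_mem_left _ h')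
  rw [tameOrder_eq_sub hq hP hu hv fun h' => absurd h' huP, primeOrder_eq_zero huP,
    primeOrder_eq_zero hvP]
  simp

theorem finite_tameOrder {u v : B} (hu : u ≠ 0) (hv : v ≠ 0) :
    ({P : PrimeSpectrum B | δ.IsDivisorial P} ∩
      Function.support fun P => tameOrder q P u v).Finite := by
  refine (finite_isDivisorial_mem (δ := δ) (mul_ne_zero hu hv)).subset ?_
  rintro P ⟨hP, h⟩
  refine ⟨hP, ?_⟩
  by_contra h'
  exact h (tameOrder_eq_zero hq hP hu hv h')

omit hq in
/-- The sum over all divisorial primes of the orders at `q` of the tame symbols. -/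
noncomputable def tameSum (δ : DimensionFunction A) (q : PrimeSpectrum A) (u v : B) : ℤ :=
  ∑ᶠ P ∈ {P : PrimeSpectrum B | δ.IsDivisorial P}, tameOrder q P u v

theorem tameSum_mul_left {u u' v : B} (hu : u ≠ 0) (hu' : u' ≠ 0) (hv : v ≠ 0) :
    tameSum δ q (u * u') v = tameSum δ q u v + tameSum δ q u' v := by
  rw [tameSum, tameSum, tameSum, ← finsum_mem_add_distrib' (finite_tameOrder hq hu hv)
    (finite_tameOrder hq hu' hv)]
  exact finsum_mem_congr rfl fun P hP => tameOrder_mul_left hq hP hu hu' hv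

theorem tameSum_swap {u v : B} (hu : u ≠ 0) (hv : v ≠ 0) :
    tameSum δ q v u = -tameSum δ q u v := by
  rw [eq_neg_iff_add_eq_zero, tameSum, tameSum, ← finsum_mem_add_distrib'
    (finite_tameOrder hq hv hu) (finite_tameOrder hq hu hv)]
  refine finsum_mem_eq_zero_of_forall_eq_zero fun P hP => ?_
  rw [tameOrder_swap hq hP hu hv, neg_add_cancel]

theorem tameSum_pow_left {u v : B} (hu : u ≠ 0) (hv : v ≠ 0) (n : ℕ) :
    tameSum δ q (u ^ n) v = n * tameSum δ q u v := by
  induction n with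
  | zero =>
    have := tameSum_mul_left hq (one_ne_zero (α := B)) one_ne_zero hv
    rw [mul_one] at this
    rw [pow_zero]
    push_cast
    linarith
  | succ n ih =>
    rw [pow_succ, tameSum_mul_left hq (pow_ne_zero n hu) hu hv, ih]
    push_cast
    ring

theorem tameSum_prod_left {ι : Type*} (s : Finset ι) (f : ι → B) {v : B}
    (hf : ∀ i ∈ s, f i ≠ 0) (hv : v ≠ 0) :
    tameSum δ q (∏ i ∈ s, f i) v = ∑ i ∈ s, tameSum δ q (f i) v := by
  classical
  induction s using Finset.induction_on with
  | empty =>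
    have := tameSum_pow_left hq (one_ne_zero (α := B)) hv 0
    rw [pow_zero] at this
    simpa using this
  | insert a s ha ih =>
    rw [Finset.prod_insert ha, Finset.sum_insert ha, tameSum_mul_left hq
      (hf a (Finset.mem_insert_self a s))
      (Finset.prod_ne_zero_iff.2 fun i hi => hf i (Finset.mem_insert_of_mem hi)) hv,
      ih fun i hi => hf i (Finset.mem_insert_of_mem hi)]

end TameSymbol

/-! ### Reciprocity for tame symbols. -/

section Reciprocity

variable {A B : Type*} [CommRing A] [CommRing B] [Algebra A B]
  [IsDomain B] [IsNoetherianRing B] [IsIntegrallyClosed B]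
  [IsNoetherianRing A] [Module.Finite A B] {δ : DimensionFunction A} {q : PrimeSpectrum A}
  (hq : δ.dim (PrimeSpectrum.comap (algebraMap A B) ⊥) = δ.dim q + 2)

include hq

omit [IsIntegrallyClosed B] in
theorem localizedLength_coker_eq_sum {u v : B} (hv : v ≠ 0) (s : Finset (PrimeSpectrum B))
    (hs : ∀ P, P ∈ s ↔ δ.IsDivisorial P ∧ v ∈ P.asIdeal)
    (huv : ∀ P ∈ s, u ∉ P.asIdeal) :
    localizedLength q (LinearMap.ker (Algebra.lsmul A A (B ⧸ Ideal.span {v}) u)) ≠ ⊤ ∧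
    localizedLength q
      ((B ⧸ Ideal.span {v}) ⧸ LinearMap.range (Algebra.lsmul A A (B ⧸ Ideal.span {v}) u)) =
      localizedLength q (LinearMap.ker (Algebra.lsmul A A (B ⧸ Ideal.span {v}) u)) +
        ((∑ P ∈ s, primeOrder P v * residueOrder q P u : ℕ) : ℕ∞) := by
  have hne {Q : PrimeSpectrum B} (hQ : Ideal.span {v} ≤ Q.asIdeal) : Q ≠ ⊥ := by
    rintro rfl
    exact hv ((Ideal.span_singleton_le_iff_mem _).1 hQ)
  obtain ⟨h1, h2⟩ := localizedLength_coker_smul q (Ideal.span {v}) u s huv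
    (fun P hP Q hQ hQP => hQP.eq_or_lt.resolve_right fun h =>
      hne hQ (((hs P).1 hP).1.isAtom.2 Q h))
    (fun Q hQ hQs => localizedLength_quotient_prime_ne_top hq (hne hQ) fun hd =>
      hQs ((hs Q).2 ⟨hd, (Ideal.span_singleton_le_iff_mem _).1 hQ⟩))
    (M := B ⧸ Ideal.span {v}) (fun x hx m => by
      obtain ⟨m, rfl⟩ := Ideal.Quotient.mk_surjective m
      exact Ideal.Quotient.eq_zero_iff_mem.2 (Ideal.mul_mem_right _ _ hx))
  refine ⟨h1, h2.trans ?_⟩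
  rw [Nat.cast_sum]
  congr 1
  refine Finset.sum_congr rfl fun P hP => ?_
  have hd := ((hs P).1 hP).1
  rw [Nat.cast_mul, primeOrder, residueOrder,
    ENat.natCast_toNat (localizedLength_quotient_span_ne_top hd.isAtom hv),
    ENat.natCast_toNat (localizedLength_residue_ne_top hq hd (huv P hP))]

/-- Compute the cokernel of `u` on `B/v` and that of `v` on `B/u` by `localizedLength_coker_eq_sum`.
Cokernels and kernels agree by symmetry and the kernels have finite length, so the two sums over
divisorial primes agree; their difference is the sum of the tame orders. -/
theorem tameSum_eq_zero_of_coprime {u v : B} (hu : u ≠ 0) (hv : v ≠ 0)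
    (huv : ∀ P : PrimeSpectrum B, δ.IsDivisorial P → u ∈ P.asIdeal → v ∉ P.asIdeal) :
    tameSum δ q u v = 0 := by
  classical
  have hfin (x : B) (hx : x ≠ 0) : ∃ s : Finset (PrimeSpectrum B),
      ∀ P, P ∈ s ↔ δ.IsDivisorial P ∧ x ∈ P.asIdeal :=
    ⟨(finite_isDivisorial_mem (δ := δ) hx).toFinset, fun P => by simp⟩
  obtain ⟨su, hsu⟩ := hfin u hu
  obtain ⟨sv, hsv⟩ := hfin v hv
  obtain ⟨h1, h2⟩ := localizedLength_coker_eq_sum hq hv sv hsv (u := u)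
    fun P hP h => huv P ((hsv P).1 hP).1 h ((hsv P).1 hP).2
  obtain ⟨-, h4⟩ := localizedLength_coker_eq_sum hq hu su hsu (u := v)
    fun P hP => huv P ((hsu P).1 hP).1 ((hsu P).1 hP).2
  rw [← localizedLength_coker_symm, ← localizedLength_ker_symm q hu hv, h2] at h4
  have h5 := Nat.cast_injective (R := ℕ∞) (ENat.add_right_injective_of_ne_top h1 h4)
  have e1 : ∑ P ∈ su ∪ sv, primeOrder P v * residueOrder q P u =
      ∑ P ∈ sv, primeOrder P v * residueOrder q P u := by
    refine (Finset.sum_subset Finset.subset_union_right fun P hP hPv => ?_).symm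
    have hPu := (Finset.mem_union.1 hP).resolve_right hPv
    rw [primeOrder_eq_zero (huv P ((hsu P).1 hPu).1 ((hsu P).1 hPu).2), zero_mul]
  have e2 : ∑ P ∈ su ∪ sv, primeOrder P u * residueOrder q P v =
      ∑ P ∈ su, primeOrder P u * residueOrder q P v := by
    refine (Finset.sum_subset Finset.subset_union_left fun P hP hPu => ?_).symm
    have hPv := (Finset.mem_union.1 hP).resolve_left hPu
    rw [primeOrder_eq_zero fun h => huv P ((hsv P).1 hPv).1 h ((hsv P).1 hPv).2, zero_mul]
  have hdiv {P} (hP : P ∈ su ∪ sv) : δ.IsDivisorial P :=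
    (Finset.mem_union.1 hP).elim (fun h => ((hsu P).1 h).1) fun h => ((hsv P).1 h).1
  have hsum : tameSum δ q u v = ∑ P ∈ su ∪ sv, tameOrder q P u v := by
    rw [tameSum]
    refine finsum_mem_eq_sum_of_inter_support_eq _ ?_
    ext P
    simp only [Set.mem_inter_iff, Set.mem_ofPred_eq, Finset.mem_coe]
    refine ⟨fun ⟨hP, h⟩ => ⟨?_, h⟩, fun ⟨hP, h⟩ => ⟨hdiv hP, h⟩⟩
    by_contra h'
    rw [Finset.mem_union, hsu, hsv] at h'
    refine h (tameOrder_eq_zero hq hP hu hv fun h'' => h' ?_)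
    exact (P.isPrime.mem_or_mem h'').imp (fun h => ⟨hP, h⟩) fun h => ⟨hP, h⟩
  rw [hsum, Finset.sum_congr rfl fun P hP =>
    tameOrder_eq_sub hq (hdiv hP) hu hv (huv P (hdiv hP)), Finset.sum_sub_distrib,
    ← Nat.cast_sum, ← Nat.cast_sum, e1, e2, h5, sub_self]

/-- Write `u / u'` as `c / d` with `c` and `d` outside all divisorial primes containing `v`. By
multiplicativity the two sums differ by those for `c` and `d`, which vanish by the coprime case. -/
theorem tameSum_congr_left {u u' v : B} (hu : u ≠ 0) (hu' : u' ≠ 0) (hv : v ≠ 0)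
    (h : ∀ P : PrimeSpectrum B, δ.IsDivisorial P → v ∈ P.asIdeal →
      primeOrder P u = primeOrder P u') :
    tameSum δ q u v = tameSum δ q u' v := by
  classical
  by_cases hs : ∃ P : PrimeSpectrum B, δ.IsDivisorial P ∧ v ∈ P.asIdeal
  swap
  · rw [tameSum_eq_zero_of_coprime hq hu hv fun P hP _ hvP => hs ⟨P, hP, hvP⟩,
      tameSum_eq_zero_of_coprime hq hu' hv fun P hP _ hvP => hs ⟨P, hP, hvP⟩]
  obtain ⟨P₀, hP₀, hvP₀⟩ := hs
  -- `J` is the ideal of denominators of `u / u'`. Equality of orders puts it in none of the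
  -- divisorial primes containing `v`, so prime avoidance finds one `d` for all of them.
  let J : Ideal B := Submodule.comap (LinearMap.mulRight B u) (Ideal.span {u'})
  have hJ (d : B) : d ∈ J ↔ ∃ c, c * u' = d * u := Ideal.mem_span_singleton'
  have hnot : ¬ (J : Set B) ⊆ ⋃ P ∈ ((finite_isDivisorial_mem (δ := δ) hv).toFinset :
      Set (PrimeSpectrum B)), (P.asIdeal : Set B) := by
    rw [Ideal.subset_union_prime P₀ P₀ fun P _ _ _ => P.isPrime]
    rintro ⟨P, hP, hle⟩
    rw [Set.Finite.mem_toFinset] at hP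
    obtain ⟨c, hc, d, hd, hcd⟩ :=
      exists_mul_eq_mul_of_primeOrder_eq hP.1.isAtom hu hu' (h P hP.1 hP.2)
    exact hd (hle ((hJ d).2 ⟨c, hcd.symm⟩))
  obtain ⟨d, hdJ, hd⟩ := Set.not_subset.1 hnot
  simp only [Set.mem_iUnion, not_exists, Set.Finite.coe_toFinset] at hd
  obtain ⟨c, hc⟩ := (hJ d).1 hdJ
  have hd' (P : PrimeSpectrum B) (hP : δ.IsDivisorial P) (hvP : v ∈ P.asIdeal) : d ∉ P.asIdeal :=
    hd P ⟨hP, hvP⟩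
  have hd0 : d ≠ 0 := fun h => hd' P₀ hP₀ hvP₀ (h ▸ P₀.asIdeal.zero_mem)
  have hc0 : c ≠ 0 := by
    rintro rfl
    rw [zero_mul] at hc
    exact mul_ne_zero hd0 hu hc.symm
  have hc' (P : PrimeSpectrum B) (hP : δ.IsDivisorial P) (hvP : v ∈ P.asIdeal) :
      c ∉ P.asIdeal := by
    rw [← primeOrder_eq_zero_iff hP.isAtom hc0]
    have := congrArg (primeOrder P) hc
    rw [primeOrder_mul hP.isAtom hc0 hu', primeOrder_mul hP.isAtom hd0 hu, h P hP hvP,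
      primeOrder_eq_zero (hd' P hP hvP)] at this
    omega
  have := tameSum_mul_left hq hd0 hu hv
  rw [← hc, tameSum_mul_left hq hc0 hu' hv,
    tameSum_eq_zero_of_coprime hq hc0 hv fun P hP h1 h2 => hc' P hP h2 h1,
    tameSum_eq_zero_of_coprime hq hd0 hv fun P hP h1 h2 => hd' P hP h2 h1] at this
  linarith

theorem tameSum_congr_right {u v v' : B} (hu : u ≠ 0) (hv : v ≠ 0) (hv' : v' ≠ 0)
    (h : ∀ P : PrimeSpectrum B, δ.IsDivisorial P → u ∈ P.asIdeal →
      primeOrder P v = primeOrder P v') :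
    tameSum δ q u v = tameSum δ q u v' := by
  rw [tameSum_swap hq hv hu, tameSum_swap hq hv' hu, tameSum_congr_left hq hv hv' hu h]

omit hq in
theorem exists_uniformizer {P : PrimeSpectrum B} (hP : δ.IsDivisorial P) {x : B} (hx : x ≠ 0) :
    ∃ π : B, π ≠ 0 ∧ primeOrder P π = 1 ∧
      ∀ Q : PrimeSpectrum B, δ.IsDivisorial Q → x ∈ Q.asIdeal → Q ≠ P → primeOrder Q π = 0 := by
  obtain ⟨π, h0, h1, h⟩ := exists_primeOrder_eq_one_notMem hP.isAtom
    (finite_isDivisorial_mem (δ := δ) hx).toFinset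
    fun Q hQ => ((Set.Finite.mem_toFinset _).1 hQ).1.isAtom
  exact ⟨π, h0, h1, fun Q hQ hxQ hQP =>
    primeOrder_eq_zero (h Q ((Set.Finite.mem_toFinset _).2 ⟨hQ, hxQ⟩) hQP)⟩

/-- Take a third uniformizer `σ` at `P` that avoids the other divisorial primes containing `π` or
`ρ`. Comparing orders gives `(π, ρ) = (π, σ) = (ρ, σ) = (ρ, π)`, while antisymmetry gives `(ρ, π) =
-(π, ρ)`; the integers have no 2-torsion. -/
theorem tameSum_eq_zero_of_uniformizer {P : PrimeSpectrum B} (hP : δ.IsDivisorial P) {π ρ : B}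
    (hπ0 : π ≠ 0) (hρ0 : ρ ≠ 0) (hπ : primeOrder P π = 1) (hρ : primeOrder P ρ = 1)
    (h : ∀ Q : PrimeSpectrum B, δ.IsDivisorial Q → π ∈ Q.asIdeal → Q ≠ P → primeOrder Q ρ = 0) :
    tameSum δ q π ρ = 0 := by
  obtain ⟨σ, hσ0, hσ, hσ'⟩ := exists_uniformizer hP (mul_ne_zero hπ0 hρ0)
  have e1 : tameSum δ q π ρ = tameSum δ q π σ := by
    refine tameSum_congr_right hq hπ0 hρ0 hσ0 fun Q hQ hQπ => ?_
    by_cases hQP : Q = P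
    · rw [hQP, hρ, hσ]
    · rw [h Q hQ hQπ hQP, hσ' Q hQ (Q.asIdeal.mul_mem_right _ hQπ) hQP]
  have e2 : tameSum δ q π σ = tameSum δ q ρ σ := by
    refine tameSum_congr_left hq hπ0 hρ0 hσ0 fun Q hQ hQσ => ?_
    by_cases hQP : Q = P
    · rw [hQP, hπ, hρ]
    · have hn : π * ρ ∉ Q.asIdeal := fun hmem =>
        (primeOrder_eq_zero_iff hQ.isAtom hσ0).1 (hσ' Q hQ hmem hQP) hQσ
      rw [primeOrder_eq_zero fun h => hn (Q.asIdeal.mul_mem_right _ h),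
        primeOrder_eq_zero fun h => hn (Q.asIdeal.mul_mem_left _ h)]
  have e3 : tameSum δ q ρ σ = tameSum δ q ρ π := by
    refine tameSum_congr_right hq hρ0 hσ0 hπ0 fun Q hQ hQρ => ?_
    by_cases hQP : Q = P
    · rw [hQP, hσ, hπ]
    · rw [hσ' Q hQ (Q.asIdeal.mul_mem_left _ hQρ) hQP, primeOrder_eq_zero]
      intro hQπ
      exact (primeOrder_eq_zero_iff hQ.isAtom hρ0).1 (h Q hQ hQπ hQP) hQρ
  have e4 := tameSum_swap hq hπ0 hρ0
  linarith

/-- Reciprocity: the orders at `q` of all tame symbols of `u` and `v` add up to zero. -/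
theorem tameSum_eq_zero {u v : B} (hu : u ≠ 0) (hv : v ≠ 0) : tameSum δ q u v = 0 := by
  classical
  set s := (finite_isDivisorial_mem (δ := δ) hv).toFinset with hs
  have hmem (P : PrimeSpectrum B) : P ∈ s ↔ δ.IsDivisorial P ∧ v ∈ P.asIdeal := by simp [hs]
  have hex (P : PrimeSpectrum B) : ∃ π : B, P ∈ s → π ≠ 0 ∧ primeOrder P π = 1 ∧
      ∀ Q : PrimeSpectrum B, δ.IsDivisorial Q → v ∈ Q.asIdeal → Q ≠ P → primeOrder Q π = 0 := by
    by_cases hP : P ∈ s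
    · obtain ⟨π, h⟩ := exists_uniformizer ((hmem P).1 hP).1 hv
      exact ⟨π, fun _ => h⟩
    · exact ⟨0, fun h => absurd h hP⟩
  choose π hπ using hex
  have hpow0 (P) (hP : P ∈ s) : π P ^ primeOrder P u ≠ 0 := pow_ne_zero _ (hπ P hP).1
  have hord {Q : PrimeSpectrum B} (hQ : δ.IsDivisorial Q) (t : Finset (PrimeSpectrum B))
      (ht : t ⊆ s) : primeOrder Q (∏ P ∈ t, π P ^ primeOrder P u) =
        ∑ P ∈ t, primeOrder P u * primeOrder Q (π P) := by
    induction t using Finset.induction_on with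
    | empty =>
      simpa using primeOrder_eq_zero ((Ideal.ne_top_iff_one _).1 Q.isPrime.ne_top)
    | insert P t hP ih =>
      rw [Finset.prod_insert hP, Finset.sum_insert hP, primeOrder_mul hQ.isAtom
        (hpow0 P (ht (Finset.mem_insert_self P t)))
        (Finset.prod_ne_zero_iff.2 fun i hi => hpow0 i (ht (Finset.mem_insert_of_mem hi))),
        ih fun i hi => ht (Finset.mem_insert_of_mem hi),
        primeOrder_pow hQ.isAtom (hπ P (ht (Finset.mem_insert_self P t))).1]
  -- The product of the `π P ^ ord_P(u)` has the same order as `u` at every divisorial prime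
  -- containing `v`.
  rw [tameSum_congr_left hq hu (Finset.prod_ne_zero_iff.2 hpow0) hv fun Q hQ hvQ => by
    have hQs := (hmem Q).2 ⟨hQ, hvQ⟩
    rw [hord hQ s subset_rfl, Finset.sum_eq_single Q, (hπ Q hQs).2.1, mul_one]
    · intro P hP hPQ
      rw [(hπ P hP).2.2 Q hQ hvQ hPQ.symm, mul_zero]
    · exact fun h => absurd hQs h]
  rw [tameSum_prod_left hq s _ hpow0 hv]
  refine Finset.sum_eq_zero fun P hP => ?_
  obtain ⟨hP0, hP1, hP'⟩ := hπ P hP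
  have hd := ((hmem P).1 hP).1
  rw [tameSum_pow_left hq hP0 hv]
  -- Among the divisorial primes containing `π P`, only `P` can contain `v` or `ρ`, so there `v` and
  -- `ρ ^ ord_P(v)` have equal orders.
  obtain ⟨ρ, hρ0, hρ1, hρ⟩ := exists_uniformizer hd hP0
  have hρv : tameSum δ q (π P) v = tameSum δ q (π P) (ρ ^ primeOrder P v) := by
    refine tameSum_congr_right hq hP0 hv (pow_ne_zero _ hρ0) fun Q hQ hQπ => ?_
    rw [primeOrder_pow hQ.isAtom hρ0]
    by_cases hQP : Q = P
    · rw [hQP, hρ1, mul_one]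
    · rw [hρ Q hQ hQπ hQP, mul_zero, primeOrder_eq_zero]
      exact fun hvQ => (primeOrder_eq_zero_iff hQ.isAtom hP0).1 (hP' Q hQ hvQ hQP) hQπ
  rw [hρv, tameSum_swap hq (pow_ne_zero _ hρ0) hP0, tameSum_pow_left hq hρ0 hP0,
    tameSum_swap hq hP0 hρ0, tameSum_eq_zero_of_uniformizer hq hd hP0 hρ0 hP1 hρ1 hρ]
  simp

end Reciprocity

/-! ### Comparing quotients by nested submodules. -/

section Index

variable {A R M : Type*} [CommRing A] [CommRing R] [Algebra A R] [AddCommGroup M] [Module R M]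
  [Module A M] [IsScalarTower A R M] (q : PrimeSpectrum A)

/-- `N₂ / N₁` is cyclic, generated by the class of `t`, with annihilator `I`. -/
theorem localizedLength_quotient_eq_add_of_span {N₁ N₂ : Submodule R M} {t : M} {I : Ideal R}
    (h : N₂ = N₁ ⊔ R ∙ t) (hI : ∀ r : R, r • t ∈ N₁ ↔ r ∈ I) :
    localizedLength q (M ⧸ N₁) = localizedLength q (R ⧸ I) + localizedLength q (M ⧸ N₂) := by
  have hle : N₁ ≤ N₂ := h ▸ le_sup_left
  let f : (R ⧸ I) →ₗ[R] (M ⧸ N₁) := Submodule.mapQ I N₁ (LinearMap.toSpanSingleton R M t)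
    fun r hr => (hI r).2 hr
  have hf : Function.Injective f := by
    refine (injective_iff_map_eq_zero f).2 fun z hz => ?_
    obtain ⟨z, rfl⟩ := Ideal.Quotient.mk_surjective z
    exact Ideal.Quotient.eq_zero_iff_mem.2 ((hI z).1 ((Submodule.Quotient.mk_eq_zero N₁).1 hz))
  have hfg : Function.Exact f (Submodule.factor hle) := by
    intro z
    obtain ⟨z, rfl⟩ := N₁.mkQ_surjective z
    constructor
    · intro hz
      have hz' : z ∈ N₂ := (Submodule.Quotient.mk_eq_zero N₂).1 hz
      rw [h] at hz'
      obtain ⟨a, ha, b, hb, rfl⟩ := Submodule.mem_sup.1 hz'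
      obtain ⟨r, rfl⟩ := Submodule.mem_span_singleton.1 hb
      refine ⟨Ideal.Quotient.mk I r, ?_⟩
      change Submodule.Quotient.mk (r • t) = Submodule.Quotient.mk (a + r • t)
      rw [eq_comm, Submodule.Quotient.eq]
      simpa using ha
    · rintro ⟨w, hw⟩
      obtain ⟨w, rfl⟩ := Ideal.Quotient.mk_surjective w
      rw [← hw]
      refine (Submodule.Quotient.mk_eq_zero N₂).2 ?_
      rw [h]
      exact Submodule.mem_sup_right (Submodule.smul_mem _ w (Submodule.mem_span_singleton_self t))
  exact localizedLength_eq_add_of_exact q (f := f.restrictScalars A)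
    (g := (Submodule.factor hle).restrictScalars A) hf (Submodule.factor_surjective hle) hfg

/-- `φ` identifies `M / N` with `φ(M) / φ(N)`. -/
theorem localizedLength_quotient_map {φ : M →ₗ[R] M} (hφ : Function.Injective φ)
    (N : Submodule R M) :
    localizedLength q (M ⧸ N.map φ) =
      localizedLength q (M ⧸ N) + localizedLength q (M ⧸ LinearMap.range φ) := by
  have hle : N.map φ ≤ LinearMap.range φ := LinearMap.map_le_range
  let f : (M ⧸ N) →ₗ[R] (M ⧸ N.map φ) := Submodule.mapQ N (N.map φ) φ (Submodule.le_comap_map φ N)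
  have hf : Function.Injective f := by
    refine (injective_iff_map_eq_zero f).2 fun z hz => ?_
    obtain ⟨z, rfl⟩ := N.mkQ_surjective z
    obtain ⟨w, hw, hwz⟩ := (Submodule.Quotient.mk_eq_zero (N.map φ)).1 hz
    exact (Submodule.Quotient.mk_eq_zero N).2 (hφ hwz ▸ hw)
  have hfg : Function.Exact f (Submodule.factor hle) := by
    intro z
    obtain ⟨z, rfl⟩ := (N.map φ).mkQ_surjective z
    constructor
    · intro hz
      obtain ⟨w, rfl⟩ := (Submodule.Quotient.mk_eq_zero (LinearMap.range φ)).1 hz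
      exact ⟨Submodule.Quotient.mk w, rfl⟩
    · rintro ⟨w, hw⟩
      obtain ⟨w, rfl⟩ := N.mkQ_surjective w
      rw [← hw]
      exact (Submodule.Quotient.mk_eq_zero (LinearMap.range φ)).2 ⟨w, rfl⟩
  exact localizedLength_eq_add_of_exact q (f := f.restrictScalars A)
    (g := (Submodule.factor hle).restrictScalars A) hf (Submodule.factor_surjective hle) hfg

end Index

/-! ### Norms in a simple extension. -/

section Norm

open Polynomial

theorem Polynomial.sub_C_mul_X_pow_mem_degreeLT {R : Type*} [CommRing R] {m : ℕ} {g : R[X]}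
    (hg : g ∈ degreeLT R (m + 1)) : g - C (g.coeff m) * X ^ m ∈ degreeLT R m := by
  rw [mem_degreeLT, degree_lt_iff_coeff_zero] at hg ⊢
  intro k hk
  rw [coeff_sub, coeff_C_mul_X_pow]
  split_ifs with h
  · rw [h, sub_self]
  · rw [hg k (by omega), sub_zero]

theorem Polynomial.divX_mem_degreeLT {R : Type*} [CommRing R] {m : ℕ} {g : R[X]}
    (hg : g ∈ degreeLT R (m + 1)) : g.divX ∈ degreeLT R m := by
  rw [mem_degreeLT, degree_lt_iff_coeff_zero] at hg ⊢
  intro k hk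
  rw [coeff_divX]
  exact hg _ (by omega)

/-- Let `f` be a nonzero polynomial of least degree `m + 1` that kills `y`, with constant term `a`
and leading coefficient `b`, so that the norm of `y` is `a / b` up to sign. The lattice `F` spanned
by `1, …, y ^ m` and its multiple `yF` both contain a lattice `G`, with `F / G = R / a` and `yF / G
= R / b`. Since `S / F` and `yS / yF` have the same length, comparing `S / F` with `S / yF` gives
the formula. -/
theorem exists_localizedLength_simple_extension {A R S : Type*} [CommRing A] [IsNoetherianRing A]
    [CommRing R] [IsDomain R] [CommRing S] [IsDomain S] [Algebra A R] [Algebra R S] [Algebra A S]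
    [IsScalarTower A R S] [Module.Finite A S] (hinj : Function.Injective (algebraMap R S)) {y : S}
    (hy : y ≠ 0) (hsurj : Function.Surjective (aeval y : R[X] →ₐ[R] S)) :
    ∃ a b : R, a ≠ 0 ∧ b ≠ 0 ∧ ∀ q : PrimeSpectrum A,
      (∀ r < q, ∀ c : R, c ≠ 0 → ∃ s ∉ r.asIdeal, c ∣ algebraMap A R s) →
      localizedLength q (S ⧸ Ideal.span {y}) + localizedLength q (R ⧸ Ideal.span {b}) =
        localizedLength q (R ⧸ Ideal.span {a}) := by
  classical
  let φ : R[X] →ₗ[R] S := (aeval y : R[X] →ₐ[R] S).toLinearMap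
  have hφX (g : R[X]) : φ (X * g) = y * φ g := by simp [φ]
  have hφC (r : R) : φ (C r) = r • 1 := by simp [φ, Algebra.algebraMap_eq_smul_one]
  have hφCX (r : R) (m : ℕ) : φ (C r * X ^ m) = r • y ^ m := by simp [φ, Algebra.smul_def]
  have hint : IsIntegral R y := (Algebra.IsIntegral.isIntegral (R := A) y).tower_top
  have hex : ∃ n : ℕ, ∃ f : R[X], f ≠ 0 ∧ f.natDegree = n ∧ φ f = 0 := by
    obtain ⟨f, hf, h⟩ := hint
    exact ⟨f.natDegree, f, hf.ne_zero, rfl, h⟩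
  obtain ⟨f, hf0, hfn, hf⟩ := Nat.find_spec hex
  generalize hn : Nat.find hex = n at hfn
  have hmin (g : R[X]) (hg : g ∈ degreeLT R n) (h : φ g = 0) : g = 0 := by
    by_contra hg0
    refine Nat.find_min hex (m := g.natDegree) ?_ ⟨g, hg0, rfl, h⟩
    rw [hn, natDegree_lt_iff_degree_lt hg0]
    exact mem_degreeLT.1 hg
  obtain ⟨m, rfl⟩ : ∃ m, n = m + 1 := by
    refine Nat.exists_eq_succ_of_ne_zero fun h0 => hf0 ?_
    rw [h0] at hfn
    rw [eq_C_of_natDegree_eq_zero hfn, hφC, ← Algebra.algebraMap_eq_smul_one] at hf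
    rw [eq_C_of_natDegree_eq_zero hfn, hinj (hf.trans (map_zero _).symm), C_0]
  have hflt : f ∈ degreeLT R (m + 1 + 1) := by
    rw [mem_degreeLT, ← natDegree_lt_iff_degree_lt hf0]
    omega
  set a := f.coeff 0 with ha
  set b := f.coeff (m + 1) with hb
  have hb0 : b ≠ 0 := by
    rw [hb, ← hfn]
    exact leadingCoeff_ne_zero.2 hf0
  have hfX : f = X * f.divX + C a := (X_mul_divX_add f).symm
  have hdf : y * φ f.divX + a • 1 = 0 := by
    rw [← hφX, ← hφC, ← map_add, ← hfX, hf]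
  have hdiv : f.divX ∈ degreeLT R (m + 1) := divX_mem_degreeLT hflt
  have ha0 : a ≠ 0 := by
    intro h0
    rw [h0, zero_smul, add_zero] at hdf
    have := hmin _ hdiv ((mul_eq_zero.1 hdf).resolve_left hy)
    rw [this, h0, mul_zero, C_0, add_zero] at hfX
    exact hf0 hfX
  have hbdiv : f.divX.coeff m = b := coeff_divX
  let μ : S →ₗ[R] S := LinearMap.mulLeft R y
  have hμ : Function.Injective μ := mul_right_injective₀ hy
  let F : Submodule R S := (degreeLT R (m + 1)).map φ
  -- `G` is spanned by `y, …, y ^ m` and `a`. It lies in `yF` because `f(y) = 0` makes `a` a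
  -- multiple of `y` by an element of `F`.
  let G : Submodule R S := ((degreeLT R m).map φ).map μ ⊔ R ∙ (a • 1 : S)
  have hG (x : S) : x ∈ G ↔ ∃ g ∈ degreeLT R m, ∃ r : R, y * φ g + (r * a) • 1 = x := by
    rw [Submodule.mem_sup]
    constructor
    · rintro ⟨_, ⟨_, ⟨g, hg, rfl⟩, rfl⟩, z, hz, rfl⟩
      obtain ⟨r, rfl⟩ := Submodule.mem_span_singleton.1 hz
      exact ⟨g, hg, r, by rw [mul_smul]; rfl⟩
    · rintro ⟨g, hg, r, rfl⟩
      exact ⟨_, ⟨_, ⟨g, hg, rfl⟩, rfl⟩, _, Submodule.mem_span_singleton.2 ⟨r, rfl⟩,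
        by rw [mul_smul]; rfl⟩
  have hmono : degreeLT R m ≤ degreeLT R (m + 1) := degreeLT_mono (Nat.le_succ m)
  have hXmul {g : R[X]} (hg : g ∈ degreeLT R m) : X * g ∈ degreeLT R (m + 1) := by
    rw [mem_degreeLT, degree_lt_iff_coeff_zero] at hg ⊢
    intro k hk
    obtain ⟨k, rfl⟩ : ∃ j, k = j + 1 := ⟨k - 1, by omega⟩
    rw [coeff_X_mul]
    exact hg k (by omega)
  have hCmem (r : R) : C r ∈ degreeLT R (m + 1) := by
    rw [mem_degreeLT]
    exact degree_C_le.trans_lt (by exact_mod_cast Nat.succ_pos m)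
  have hCXmem (r : R) : C r * X ^ m ∈ degreeLT R (m + 1) := by
    rw [mem_degreeLT]
    exact (degree_C_mul_X_pow_le m r).trans_lt (by exact_mod_cast Nat.lt_succ_self m)
  have hFG : F = G ⊔ R ∙ (1 : S) := by
    refine le_antisymm ?_ (sup_le ?_ ?_)
    · rintro _ ⟨g, hg, rfl⟩
      rw [← X_mul_divX_add g, map_add, hφX, hφC]
      refine add_mem (Submodule.mem_sup_left ((hG _).2 ⟨g.divX, divX_mem_degreeLT hg, 0, by simp⟩))
        (Submodule.mem_sup_right (Submodule.mem_span_singleton.2 ⟨_, rfl⟩))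
    · intro x hx
      obtain ⟨g, hg, r, rfl⟩ := (hG x).1 hx
      exact ⟨X * g + C (r * a), add_mem (hXmul hg) (hCmem _), by rw [map_add, hφX, hφC]⟩
    · rw [Submodule.span_singleton_le_iff_mem]
      exact ⟨C 1, hCmem 1, by rw [hφC, one_smul]⟩
  have hFG' : F.map μ = G ⊔ R ∙ (y ^ (m + 1)) := by
    refine le_antisymm ?_ (sup_le ?_ ?_)
    · rintro _ ⟨_, ⟨g, hg, rfl⟩, rfl⟩
      have h1 : μ (φ g) = y * φ (g - C (g.coeff m) * X ^ m) + g.coeff m • y ^ (m + 1) := by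
        rw [map_sub, hφCX, mul_sub, mul_smul_comm, ← pow_succ', sub_add_cancel]
        rfl
      rw [h1]
      exact add_mem (Submodule.mem_sup_left ((hG _).2 ⟨_, sub_C_mul_X_pow_mem_degreeLT hg, 0,
        by simp⟩)) (Submodule.mem_sup_right (Submodule.mem_span_singleton.2 ⟨_, rfl⟩))
    · intro x hx
      obtain ⟨g, hg, r, rfl⟩ := (hG x).1 hx
      refine ⟨φ (g - r • f.divX), ⟨_, sub_mem (hmono hg) (Submodule.smul_mem _ r hdiv), rfl⟩, ?_⟩
      change y * φ (g - r • f.divX) = _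
      rw [map_sub, map_smul, mul_sub, mul_smul_comm, eq_neg_of_add_eq_zero_left hdf, mul_smul,
        smul_neg, sub_neg_eq_add]
    · rw [Submodule.span_singleton_le_iff_mem]
      refine ⟨_, ⟨_, hCXmem 1, rfl⟩, ?_⟩
      rw [hφCX, one_smul, pow_succ']
      rfl
  have hIa (r : R) : r • (1 : S) ∈ G ↔ r ∈ Ideal.span {a} := by
    rw [hG, Ideal.mem_span_singleton']
    constructor
    · rintro ⟨g, hg, s, h⟩
      refine ⟨s, ?_⟩
      have h0 := hmin (X * g + C (s * a - r)) (add_mem (hXmul hg) (hCmem _)) (by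
        rw [map_add, hφX, hφC, sub_smul, ← h]
        abel)
      have := congrArg (coeff · 0) h0
      simp only [coeff_add, mul_coeff_zero, coeff_X_zero, zero_mul, coeff_C_zero, zero_add,
        coeff_zero] at this
      exact sub_eq_zero.1 this
    · rintro ⟨s, rfl⟩
      exact ⟨0, Submodule.zero_mem _, s, by simp⟩
  have hIb (r : R) : r • y ^ (m + 1) ∈ G ↔ r ∈ Ideal.span {b} := by
    rw [hG, Ideal.mem_span_singleton']
    constructor
    · rintro ⟨g, hg, s, h⟩
      have h0 := hmin (C r * X ^ m - g + s • f.divX)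
        (add_mem (sub_mem (hCXmem r) (hmono hg)) (Submodule.smul_mem _ s hdiv)) (by
          refine (mul_eq_zero.1 ?_).resolve_left hy
          rw [map_add, map_sub, hφCX, map_smul, mul_add, mul_sub, mul_smul_comm, mul_smul_comm,
            ← pow_succ', ← h, eq_neg_of_add_eq_zero_left hdf, mul_smul, smul_neg]
          abel)
      have := congrArg (coeff · m) h0
      rw [mem_degreeLT, degree_lt_iff_coeff_zero] at hg
      simp only [coeff_add, coeff_sub, coeff_C_mul_X_pow, if_true, hg m le_rfl, coeff_smul, hbdiv,
        coeff_zero, smul_eq_mul, sub_zero] at this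
      exact ⟨-s, by rw [neg_mul]; exact (eq_neg_of_add_eq_zero_left this).symm⟩
    · rintro ⟨s, rfl⟩
      refine ⟨-(s • (f.divX - C (f.divX.coeff m) * X ^ m)), neg_mem (Submodule.smul_mem _ s
        (sub_C_mul_X_pow_mem_degreeLT hdiv)), -s, ?_⟩
      rw [map_neg, map_smul, map_sub, hφCX, hbdiv, mul_neg, mul_smul_comm, mul_sub, mul_smul_comm,
        eq_neg_of_add_eq_zero_left hdf, ← pow_succ', neg_mul, neg_smul, mul_smul, mul_smul,
        smul_sub, smul_neg]
      abel
  -- `S / F` is torsion over `R`: multiplying by `b` allows the top coefficient to be removed with a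
  -- multiple of `f`. With the hypothesis on `q` this makes its length at `q` finite, so that it can
  -- be cancelled.
  have htors (k : ℕ) : ∀ g ∈ degreeLT R (m + 1 + k), ∃ c : R, c ≠ 0 ∧ c • φ g ∈ F := by
    induction k with
    | zero => exact fun g hg => ⟨1, one_ne_zero, by rw [one_smul]; exact ⟨g, hg, rfl⟩⟩
    | succ k ih =>
      intro g hg
      obtain ⟨c, hc, h⟩ := ih (C b * g - C (g.coeff (m + 1 + k)) * X ^ k * f) (by
        rw [mem_degreeLT, degree_lt_iff_coeff_zero] at hg hflt ⊢
        intro j hj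
        rw [coeff_sub, coeff_C_mul, mul_assoc, coeff_C_mul, show j = (j - k) + k by omega,
          coeff_X_pow_mul]
        rcases hj.eq_or_lt with h | h
        · rw [← h, Nat.add_sub_cancel, ← hb]
          ring
        · rw [hflt (j - k) (by omega), hg _ (by omega)]
          ring)
      refine ⟨c * b, mul_ne_zero hc hb0, ?_⟩
      have h1 : φ (C b * g - C (g.coeff (m + 1 + k)) * X ^ k * f) = b • φ g := by
        have : φ (C (g.coeff (m + 1 + k)) * X ^ k * f) = 0 := by
          change aeval y _ = 0
          rw [map_mul, show aeval y f = 0 from hf, mul_zero]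
        rw [map_sub, this, sub_zero, ← smul_eq_C_mul, map_smul]
      rw [mul_smul, ← h1]
      exact h
  refine ⟨a, b, ha0, hb0, fun q hq => ?_⟩
  have : Module.Finite A (S ⧸ F) := Module.Finite.of_surjective
    ((Submodule.mkQ F).restrictScalars A) (Submodule.mkQ_surjective F)
  have hfin : localizedLength q (S ⧸ F) ≠ ⊤ := by
    refine localizedLength_ne_top q fun r hr => (localizedLength_eq_zero_iff r).2 fun x => ?_
    obtain ⟨x, rfl⟩ := Submodule.mkQ_surjective F x
    obtain ⟨g, rfl⟩ := hsurj x
    obtain ⟨c, hc, h⟩ := htors (g.natDegree + 1) g (by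
      rw [mem_degreeLT]
      exact degree_le_natDegree.trans_lt (by exact_mod_cast (by omega)))
    obtain ⟨s, hs, d, hd⟩ := hq r hr c hc
    refine ⟨s, hs, ?_⟩
    rw [← algebraMap_smul R s, hd, mul_comm, mul_smul, ← map_smul]
    rw [show (Submodule.mkQ F) (c • (aeval y) g) = 0 from (Submodule.Quotient.mk_eq_zero F).2 h,
      smul_zero]
  have e1 := localizedLength_quotient_eq_add_of_span q hFG hIa
  have e2 := localizedLength_quotient_eq_add_of_span q hFG' hIb
  rw [localizedLength_quotient_map q hμ F, e1] at e2
  have hrange : LinearMap.range μ = (Ideal.span {y}).restrictScalars R := by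
    ext x
    exact ⟨fun ⟨z, hz⟩ => Ideal.mem_span_singleton'.2 ⟨z, by rw [mul_comm]; exact hz⟩, fun hx => by
      obtain ⟨z, hz⟩ := Ideal.mem_span_singleton'.1 hx
      exact ⟨z, by rw [← hz, mul_comm]; rfl⟩⟩
  rw [hrange] at e2
  refine ENat.add_right_injective_of_ne_top hfin ?_
  dsimp only
  rw [add_comm _ (localizedLength q (R ⧸ Ideal.span {a})), e2]
  change _ + (localizedLength q (S ⧸ Ideal.span {y}) + _) = _ + (_ + localizedLength q (S ⧸ Ideal.span {y}))
  ring

end Norm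

/-! ### Norms in a finite extension. -/

section Norm

theorem localizedLength_quotient_span_algebraMap {A R : Type*} [CommRing A] [CommRing R]
    [Algebra A R] (hsurj : Function.Surjective (algebraMap A R)) (q : PrimeSpectrum A) (a : A) :
    localizedLength q (R ⧸ Ideal.span {algebraMap A R a}) =
      localizedLength q (A ⧸ (RingHom.ker (algebraMap A R) ⊔ Ideal.span {a})) := by
  rw [localizedLength_quotient_comap q hsurj, ← Set.image_singleton, ← Ideal.map_span,
    Ideal.comap_map_of_surjective _ hsurj, sup_comm]
  rfl

/-- Passing from a finite extension of domains to a larger one multiplies all lengths of quotients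
by principal ideals by the generic rank. -/
theorem exists_localizedLength_eq_mul {A C S : Type*} [CommRing A] [CommRing C] [IsDomain C]
    [CommRing S] [IsDomain S] [Algebra A C] [Algebra C S] [Algebra A S] [IsScalarTower A C S]
    [IsNoetherianRing A] [Module.Finite A C] [Module.Finite C S]
    (hinj : Function.Injective (algebraMap C S)) {y : C} (hy : y ≠ 0) :
    ∃ m : ℕ, ∀ q : PrimeSpectrum A,
      (∀ r < q, PrimeSpectrum.comap (algebraMap A C) ⊥ ≤ r →
        r = PrimeSpectrum.comap (algebraMap A C) ⊥) →
      localizedLength q (S ⧸ Ideal.span {algebraMap C S y}) =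
        m * localizedLength q (C ⧸ Ideal.span {y}) := by
  have : IsNoetherianRing C := IsNoetherianRing.of_finite A C
  have hgen : localizedLength (⊥ : PrimeSpectrum C) S ≠ ⊤ :=
    localizedLength_ne_top _ fun r hr => absurd hr not_lt_bot
  refine ⟨(localizedLength (⊥ : PrimeSpectrum C) S).toNat, fun q hq => ?_⟩
  -- Dévissage of `S` over `C`: nonzero primes of `C` have finite length at `q`, so only `⊥` counts,
  -- weighted by the generic rank.
  obtain ⟨-, h⟩ := localizedLength_coker_smul q (⊥ : Ideal C) y {⊥} (M := S)
    (by simpa using hy) (by simp)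
    (fun Q _ hQ => localizedLength_ne_top q fun r hr =>
      localizedLength_quotient_eq_zero_of_comap fun hle => by
        have hlt := PrimeSpectrum.comap_algebraMap_lt (A := A)
          (bot_lt_iff_ne_bot.2 (by simpa using hQ : Q ≠ ⊥))
        have hle' : PrimeSpectrum.comap (algebraMap A C) Q ≤ r := hle
        exact (hlt.trans_le hle').ne' (hq r hr (hlt.le.trans hle')))
    (fun x hx m => by rw [(Submodule.mem_bot C).1 hx, zero_smul])
  have hy' : algebraMap C S y ≠ 0 := (map_ne_zero_iff _ hinj).2 hy
  have hker : LinearMap.ker (Algebra.lsmul A A S y) = ⊥ := by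
    refine (Submodule.eq_bot_iff _).2 fun x hx => ?_
    have hx' : y • x = 0 := hx
    rw [Algebra.smul_def] at hx'
    exact (mul_eq_zero.1 hx').resolve_left hy'
  have hrange : LinearMap.range (Algebra.lsmul A A S y) =
      (Ideal.span {algebraMap C S y}).restrictScalars A := by
    ext x
    have h1 : x ∈ LinearMap.range (Algebra.lsmul A A S y) ↔ ∃ z : S, y • z = x := Iff.rfl
    have h2 : x ∈ (Ideal.span {algebraMap C S y}).restrictScalars A ↔
        ∃ z : S, z * algebraMap C S y = x := Ideal.mem_span_singleton'
    rw [h1, h2]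
    exact exists_congr fun z => by rw [Algebra.smul_def, mul_comm]
  rw [hker, hrange, localizedLength_eq_zero_of_subsingleton q (M := (⊥ : Submodule A S)), zero_add, Finset.sum_singleton,
    PrimeSpectrum.asIdeal_bot, bot_sup_eq] at h
  rw [ENat.natCast_toNat hgen]
  exact h

/-- The tower `R ⊆ C = R[y] ⊆ S` splits the norm: the simple extension gives `a` and `b`, and the
generic rank of `S` over `C` gives `m`. -/
theorem exists_localizedLength_eq_norm_of_adjoin {A R C S : Type*} [CommRing A]
    [IsNoetherianRing A] [CommRing R] [IsDomain R] [CommRing C] [IsDomain C] [CommRing S]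
    [IsDomain S] [Algebra A R] [Algebra A C] [Algebra A S] [Algebra R C] [Algebra C S]
    [IsScalarTower A R C] [IsScalarTower A C S] [Module.Finite A C] [Module.Finite A S]
    (hAR : Function.Surjective (algebraMap A R)) (hRC : Function.Injective (algebraMap R C))
    (hCS : Function.Injective (algebraMap C S)) {y : C} (hy : y ≠ 0)
    (hsurj : Function.Surjective (Polynomial.aeval y : Polynomial R →ₐ[R] C))
    {p : PrimeSpectrum A} (hp : RingHom.ker (algebraMap A R) = p.asIdeal) :
    ∃ (m : ℕ) (a b : A), a ∉ p.asIdeal ∧ b ∉ p.asIdeal ∧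
      ∀ q : PrimeSpectrum A, (∀ r < q, p ≤ r → r = p) →
      localizedLength q (S ⧸ Ideal.span {algebraMap C S y}) +
          m * localizedLength q (A ⧸ (p.asIdeal ⊔ Ideal.span {b})) =
        m * localizedLength q (A ⧸ (p.asIdeal ⊔ Ideal.span {a})) := by
  have : Module.Finite C S := Module.Finite.of_restrictScalars_finite A C S
  have hpR (x : A) : x ∈ p.asIdeal ↔ algebraMap A R x = 0 := by rw [← hp, RingHom.mem_ker]
  have hbot : PrimeSpectrum.comap (algebraMap A C) ⊥ = p := by
    ext x
    have h1 : x ∈ (PrimeSpectrum.comap (algebraMap A C) ⊥).asIdeal ↔ algebraMap A C x = 0 :=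
      Iff.rfl
    rw [h1, hpR, IsScalarTower.algebraMap_apply A R C, map_eq_zero_iff _ hRC]
  obtain ⟨a, b, ha, hb, hab⟩ := exists_localizedLength_simple_extension (A := A) hRC hy hsurj
  obtain ⟨m, hm⟩ := exists_localizedLength_eq_mul (A := A) hCS hy
  obtain ⟨a, rfl⟩ := hAR a
  obtain ⟨b, rfl⟩ := hAR b
  refine ⟨m, a, b, fun h => ha ((hpR a).1 h), fun h => hb ((hpR b).1 h), fun q hq => ?_⟩
  have h1 := hab q fun r hr c hc => by
    obtain ⟨c, rfl⟩ := hAR c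
    -- Either `r = p`, and a lift of `c` itself lies outside `r`, or an element of `p` outside `r`
    -- maps to zero, a multiple of everything.
    by_cases hpr : p ≤ r
    · rw [hq r hr hpr]
      exact ⟨c, fun h => hc ((hpR c).1 h), dvd_rfl⟩
    · obtain ⟨s, hs, hsr⟩ := Set.not_subset.1 hpr
      exact ⟨s, hsr, by rw [(hpR s).1 hs]; exact dvd_zero _⟩
  rw [localizedLength_quotient_span_algebraMap hAR, localizedLength_quotient_span_algebraMap hAR,
    hp] at h1
  rw [hm q (by rwa [hbot]), ← h1, mul_add]

variable {A S : Type*} [CommRing A] [IsNoetherianRing A] [CommRing S] [IsDomain S] [Algebra A S]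
  [Module.Finite A S]

/-- The function `q ↦ ℓ_q(S/y)` is, up to a factor, the divisor of an element of the fraction
field of the image of `A` in `S`. -/
theorem exists_localizedLength_eq_norm {y : S} (hy : y ≠ 0) {p : PrimeSpectrum A}
    (hp : RingHom.ker (algebraMap A S) = p.asIdeal) :
    ∃ (m : ℕ) (a b : A), a ∉ p.asIdeal ∧ b ∉ p.asIdeal ∧
      ∀ q : PrimeSpectrum A, (∀ r < q, p ≤ r → r = p) →
      localizedLength q (S ⧸ Ideal.span {y}) +
          m * localizedLength q (A ⧸ (p.asIdeal ⊔ Ideal.span {b})) =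
        m * localizedLength q (A ⧸ (p.asIdeal ⊔ Ideal.span {a})) := by
  let R : Subalgebra A S := ⊥
  let C : Subalgebra R S := Algebra.adjoin R {y}
  have hAR : Function.Surjective (algebraMap A R) := by
    rintro ⟨x, hx⟩
    obtain ⟨a, rfl⟩ := Algebra.mem_bot.1 hx
    exact ⟨a, rfl⟩
  have hker : RingHom.ker (algebraMap A R) = p.asIdeal := by
    rw [← hp]
    ext x
    exact Subtype.ext_iff (a1 := algebraMap A R x) (a2 := 0)
  have : IsScalarTower A R C := IsScalarTower.of_algebraMap_eq fun x => rfl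
  have : IsScalarTower A C S := IsScalarTower.of_algebraMap_eq fun x => rfl
  have : Module.Finite A C :=
    Module.Finite.of_injective (C.val.restrictScalars A).toLinearMap Subtype.val_injective
  let y' : C := ⟨y, Algebra.self_mem_adjoin_singleton R y⟩
  have hy' : y' ≠ 0 := fun h => hy congr(($h).1)
  have hsurj : Function.Surjective (Polynomial.aeval y' : Polynomial R →ₐ[R] C) := by
    rintro ⟨x, hx⟩
    have hx' : x ∈ Algebra.adjoin R {y} := hx
    rw [Algebra.adjoin_singleton_eq_range_aeval] at hx'
    obtain ⟨g, hg⟩ := hx'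
    exact ⟨g, Subtype.ext ((Polynomial.aeval_algHom_apply C.val y' g).symm.trans hg)⟩
  have hRC : Function.Injective (algebraMap R C) := fun x z h =>
    Subtype.ext (congrArg (fun c : C => (c : S)) h)
  exact exists_localizedLength_eq_norm_of_adjoin (R := R) (C := C) (S := S) hAR hRC
    Subtype.val_injective hy' hsurj hker

end Norm

/-! ### Comparing divisors on `A`, on its quotients and on a finite extension. -/

section Comparison

variable {A : Type*} [CommRing A] [IsNoetherianRing A] {δ : DimensionFunction A}

theorem PrimeCycle.div_apply {p : PrimeSpectrum A} {x : A} (hx : x ∉ p.asIdeal)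
    (q : PrimeSpectrum A) :
    PrimeCycle.div δ p x hx q =
      if δ.dim p = δ.dim q + 1 then ((PrimeCycle.localLength p x q).toNat : ℤ) else 0 := rfl

theorem PrimeCycle.le_of_div_apply_ne_zero {p : PrimeSpectrum A} {x : A} (hx : x ∉ p.asIdeal)
    {q : PrimeSpectrum A} (h : PrimeCycle.div δ p x hx q ≠ 0) :
    p.asIdeal ⊔ Ideal.span {x} ≤ q.asIdeal := by
  rw [PrimeCycle.div_apply] at h
  refine PrimeCycle.le_of_localLength_ne_zero fun h0 => h ?_
  simp [h0]

theorem PrimeCycle.incl_div (I : Ideal A) (P : PrimeSpectrum (A ⧸ I)) (x : A)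
    (hx : Ideal.Quotient.mk I x ∉ P.asIdeal)
    (hx' : x ∉ (PrimeSpectrum.comap (Ideal.Quotient.mk I) P).asIdeal) :
    PrimeCycle.incl I (PrimeCycle.div (δ.quotient I) P (Ideal.Quotient.mk I x) hx) =
      PrimeCycle.div δ (PrimeSpectrum.comap (Ideal.Quotient.mk I) P) x hx' := by
  have hsurj : Function.Surjective (Ideal.Quotient.mk I) := Ideal.Quotient.mk_surjective
  have hIP : I ≤ P.asIdeal.comap (Ideal.Quotient.mk I) := fun y hy => by
    rw [Ideal.mem_comap, Ideal.Quotient.eq_zero_iff_mem.2 hy]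
    exact P.asIdeal.zero_mem
  ext q
  by_cases hq : q ∈ Set.range (PrimeSpectrum.comap (Ideal.Quotient.mk I))
  · obtain ⟨q, rfl⟩ := hq
    have hcomap : (P.asIdeal ⊔ Ideal.span {Ideal.Quotient.mk I x}).comap (algebraMap A (A ⧸ I)) =
        (PrimeSpectrum.comap (Ideal.Quotient.mk I) P).asIdeal ⊔ Ideal.span {x} := by
      have h1 : P.asIdeal ⊔ Ideal.span {Ideal.Quotient.mk I x} =
          (P.asIdeal.comap (Ideal.Quotient.mk I) ⊔ Ideal.span {x}).map
            (Ideal.Quotient.mk I) := by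
        rw [Ideal.map_sup, Ideal.map_comap_of_surjective _ hsurj, Ideal.map_span,
          Set.image_singleton]
      rw [h1]
      change Ideal.comap (Ideal.Quotient.mk I) _ = _
      rw [Ideal.comap_map_of_surjective _ hsurj]
      exact sup_eq_left.2
        (le_trans (fun y hy => hIP (Ideal.Quotient.eq_zero_iff_mem.1 hy)) le_sup_left)
    have hlen : PrimeCycle.localLength P (Ideal.Quotient.mk I x) q =
        PrimeCycle.localLength (PrimeSpectrum.comap (Ideal.Quotient.mk I) P) x
          (PrimeSpectrum.comap (Ideal.Quotient.mk I) q) := by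
      rw [PrimeCycle.localLength_eq, PrimeCycle.localLength_eq, ← localizedLength_comap_quotient,
        localizedLength_quotient_comap (B := A) _ hsurj, hcomap]
    change Finsupp.mapDomain _ _ _ = _
    rw [Finsupp.mapDomain_apply (PrimeCycle.comap_mk_injective I), PrimeCycle.div_apply,
      PrimeCycle.div_apply, hlen]
    rfl
  · change Finsupp.mapDomain _ _ _ = _
    rw [Finsupp.mapDomain_of_notMem_range _ _ hq]
    by_contra h
    refine hq ?_
    rw [range_comap_of_surjective _ _ hsurj, Ideal.mk_ker]
    exact hIP.trans (le_sup_left.trans (PrimeCycle.le_of_div_apply_ne_zero hx' (Ne.symm h)))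

theorem PrimeCycle.incl_cap_single (u : A) (p : PrimeSpectrum A) [Decidable (u ∈ p.asIdeal)]
    (n : ℤ) :
    PrimeCycle.incl (Ideal.span {u}) (PrimeCycle.cap δ u (Finsupp.single p n)) =
      if h : u ∈ p.asIdeal then 0 else n • PrimeCycle.div δ p u h := by
  have h0 : PrimeCycle.cap δ u (Finsupp.single p n) = n • PrimeCycle.capPrime δ u p :=
    Finsupp.linearCombination_single ℤ n p
  rw [h0, map_zsmul]
  split_ifs with h
  · rw [PrimeCycle.capPrime, dif_pos h, map_zero, smul_zero]
  · rw [PrimeCycle.incl_capPrime]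

open Classical in
theorem PrimeCycle.incl_cap_apply (u : A) (c : PrimeCycle A) (q : PrimeSpectrum A) :
    PrimeCycle.incl (Ideal.span {u}) (PrimeCycle.cap δ u c) q =
      ∑ P ∈ c.support, c P * if u ∈ P.asIdeal then 0 else
        if δ.dim P = δ.dim q + 1 then ((PrimeCycle.localLength P u q).toNat : ℤ) else 0 := by
  conv_lhs => rw [← Finsupp.sum_single c, Finsupp.sum, map_sum, map_sum, Finsupp.finsetSum_apply]
  refine Finset.sum_congr rfl fun P _ => ?_
  rw [PrimeCycle.incl_cap_single]
  by_cases h : u ∈ P.asIdeal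
  · simp [h]
  · rw [dif_neg h, if_neg h, Finsupp.smul_apply, PrimeCycle.div_apply, smul_eq_mul]

variable {B : Type*} [CommRing B] [IsDomain B] [Algebra A B] [Module.Finite A B]
  {p : PrimeSpectrum A} (hp : PrimeSpectrum.comap (algebraMap A B) ⊥ = p)
include hp

omit [IsNoetherianRing A] [Module.Finite A B] in
theorem algebraMap_eq_zero_iff_mem (x : A) : algebraMap A B x = 0 ↔ x ∈ p.asIdeal := by
  rw [← hp]
  exact Iff.rfl

/-- Let `R` be the image of `A` in `B`. Birationality makes `B / R` of finite length at `P₀`, so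
kernel and cokernel of `v` on it cancel in the snake lemma and `R / v` and `B / v` have equal
length. -/
theorem localLength_eq_localizedLength_of_birational
    (hbir : ∀ b : B, ∃ a ∉ p.asIdeal, ∃ c : A, a • b = algebraMap A B c) {v : A}
    (hv : v ∉ p.asIdeal) {P₀ : PrimeSpectrum A} (hP₀ : δ.dim p = δ.dim P₀ + 1) :
    PrimeCycle.localLength p v P₀ =
      localizedLength P₀ (B ⧸ Ideal.span {algebraMap A B v}) := by
  let R : Subalgebra A B := ⊥
  have hAR : Function.Surjective (algebraMap A R) := by
    rintro ⟨x, hx⟩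
    obtain ⟨a, rfl⟩ := Algebra.mem_bot.1 hx
    exact ⟨a, rfl⟩
  have hker : RingHom.ker (algebraMap A R) = p.asIdeal := by
    ext x
    rw [← algebraMap_eq_zero_iff_mem hp]
    exact Subtype.ext_iff (a1 := algebraMap A R x) (a2 := 0)
  have hvB : algebraMap A B v ≠ 0 := fun h => hv ((algebraMap_eq_zero_iff_mem hp v).1 h)
  let f : R →ₗ[A] B := R.val.toLinearMap
  let g : B →ₗ[A] B ⧸ LinearMap.range f := (LinearMap.range f).mkQ
  have hinjB : LinearMap.ker (LinearMap.lsmul A B v) = ⊥ := by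
    refine (Submodule.eq_bot_iff _).2 fun x hx => ?_
    have hx' : v • x = 0 := hx
    rw [Algebra.smul_def] at hx'
    exact (mul_eq_zero.1 hx').resolve_left hvB
  have hinjR : LinearMap.ker (LinearMap.lsmul A R v) = ⊥ := by
    refine (Submodule.eq_bot_iff _).2 fun x hx => Subtype.ext ?_
    have hx' : v • (x : B) = 0 := congr(($(show v • x = 0 from hx)).1)
    rw [Algebra.smul_def] at hx'
    exact (mul_eq_zero.1 hx').resolve_left hvB
  have hfin : localizedLength P₀ (B ⧸ LinearMap.range f) ≠ ⊤ := by
    refine localizedLength_ne_top P₀ fun r hr => (localizedLength_eq_zero_iff r).2 fun x => ?_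
    obtain ⟨b, rfl⟩ := Submodule.mkQ_surjective _ x
    by_cases hpr : p ≤ r
    · have hrp : p = r := by
        refine δ.eq_of_le_of_dim_eq hpr ?_
        have h1 := δ.dim_lt_of_lt _ _ hr
        have h2 := δ.dim_le_of_le hpr
        omega
      obtain ⟨a, ha, c, hc⟩ := hbir b
      refine ⟨a, hrp ▸ ha, ?_⟩
      rw [← map_smul, hc]
      exact (Submodule.Quotient.mk_eq_zero _).2 ⟨algebraMap A R c, rfl⟩
    · obtain ⟨s, hs, hsr⟩ := Set.not_subset.1 hpr
      refine ⟨s, hsr, ?_⟩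
      rw [← map_smul, Algebra.smul_def, (algebraMap_eq_zero_iff_mem hp s).2 hs, zero_mul, map_zero]
  obtain ⟨h, -⟩ := localizedLength_snake P₀ (f := f) (g := g) Subtype.val_injective
    (Submodule.mkQ_surjective _) (LinearMap.exact_map_mkQ_range f)
    (LinearMap.lsmul A R v) (LinearMap.lsmul A B v) (LinearMap.lsmul A _ v)
    (LinearMap.ext fun x => rfl) (LinearMap.ext fun x => rfl)
  rw [hinjB, hinjR, localizedLength_eq_zero_of_subsingleton P₀ (M := (⊥ : Submodule A R)),
    localizedLength_eq_zero_of_subsingleton P₀ (M := (⊥ : Submodule A B)), zero_add, zero_add,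
    localizedLength_ker_eq_coker P₀ hfin] at h
  have hker_fin : localizedLength P₀
      (LinearMap.ker (LinearMap.lsmul A (B ⧸ LinearMap.range f) v)) ≠ ⊤ :=
    ne_top_of_le_ne_top hfin (localizedLength_le_of_injective P₀ (Submodule.subtype_injective _))
  have h' := ENat.add_right_injective_of_ne_top hker_fin
    ((h.trans (add_comm _ _) : _ = localizedLength P₀
      (LinearMap.ker (LinearMap.lsmul A (B ⧸ LinearMap.range f) v)) + _))
  have hrangeB : LinearMap.range (LinearMap.lsmul A B v) =
      (Ideal.span {algebraMap A B v}).restrictScalars A := by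
    ext x
    have h1 : x ∈ LinearMap.range (LinearMap.lsmul A B v) ↔ ∃ z : B, v • z = x := Iff.rfl
    have h2 : x ∈ (Ideal.span {algebraMap A B v}).restrictScalars A ↔
        ∃ z : B, z * algebraMap A B v = x := Ideal.mem_span_singleton'
    rw [h1, h2]
    exact exists_congr fun z => by rw [Algebra.smul_def, mul_comm]
  have hrangeR : LinearMap.range (LinearMap.lsmul A R v) =
      (Ideal.span {algebraMap A R v}).restrictScalars A := by
    ext x
    have h1 : x ∈ LinearMap.range (LinearMap.lsmul A R v) ↔ ∃ z : R, v • z = x := Iff.rfl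
    have h2 : x ∈ (Ideal.span {algebraMap A R v}).restrictScalars A ↔
        ∃ z : R, z * algebraMap A R v = x := Ideal.mem_span_singleton'
    rw [h1, h2]
    exact exists_congr fun z => by rw [Algebra.smul_def, mul_comm]
  rw [hrangeB, hrangeR] at h'
  rw [PrimeCycle.localLength_eq, ← hker, ← localizedLength_quotient_span_algebraMap hAR]
  exact h'.symm

omit [IsNoetherianRing A] [Module.Finite A B] in
theorem DimensionFunction.IsDivisorial.dim_eq {Q : PrimeSpectrum B} (hQ : δ.IsDivisorial Q) :
    δ.dim p = δ.dim (PrimeSpectrum.comap (algebraMap A B) Q) + 1 := by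
  rw [← hp]
  exact hQ

omit hp [IsDomain B] in
theorem localizedLength_comap_self_ne_top (Q : PrimeSpectrum B) :
    localizedLength (PrimeSpectrum.comap (algebraMap A B) Q) (B ⧸ Q.asIdeal) ≠ ⊤ :=
  localizedLength_ne_top _ fun _ hr => localizedLength_quotient_eq_zero_of_comap hr.not_ge

/-- Dévissage of `B / v` over `B`: a prime containing `v` that is not divisorial has length zero at
`P₀`. -/
theorem localizedLength_quotient_span_eq_sum {v : B} (hv : v ≠ 0) (s : Finset (PrimeSpectrum B))
    (hs : ∀ P, P ∈ s ↔ δ.IsDivisorial P ∧ v ∈ P.asIdeal) {P₀ : PrimeSpectrum A}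
    (hP₀ : δ.dim p = δ.dim P₀ + 1) :
    localizedLength P₀ (B ⧸ Ideal.span {v}) =
      ∑ Q ∈ s, localizedLength Q (B ⧸ Ideal.span {v}) * localizedLength P₀ (B ⧸ Q.asIdeal) := by
  have : IsNoetherianRing B := IsNoetherianRing.of_finite A B
  have hne {Q : PrimeSpectrum B} (hQ : Ideal.span {v} ≤ Q.asIdeal) : Q ≠ ⊥ := by
    rintro rfl
    exact hv ((Ideal.span_singleton_le_iff_mem _).1 hQ)
  exact localizedLength_eq_sum P₀ (Ideal.span {v}) s
    (fun P hP Q hQ hQP => hQP.eq_or_lt.resolve_right fun h =>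
      hne hQ (((hs P).1 hP).1.isAtom.2 Q h))
    (fun Q hQ hQs => localizedLength_quotient_eq_zero_of_comap fun hle =>
      hQs ((hs Q).2 ⟨isDivisorial_of_le (by rw [hp]; exact hP₀.le) (hne hQ) hle,
        (Ideal.span_singleton_le_iff_mem _).1 hQ⟩))
    (fun x hx m => by
      obtain ⟨m, rfl⟩ := Ideal.Quotient.mk_surjective m
      exact Ideal.Quotient.eq_zero_iff_mem.2 (Ideal.mul_mem_right _ _ hx))

-- Dévissage of `B / Q` as an `A`-module: at `q` only its generic length along the contraction `P₀`
-- counts, and `u` acts injectively.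
omit hp [IsDomain B] in
theorem localizedLength_residue_eq_mul {Q : PrimeSpectrum B} {u : A}
    {P₀ : PrimeSpectrum A} (hP₀ : PrimeSpectrum.comap (algebraMap A B) Q = P₀)
    (hu : u ∉ P₀.asIdeal) {q : PrimeSpectrum A} (hq : δ.dim P₀ = δ.dim q + 1) :
    localizedLength q (B ⧸ (Q.asIdeal ⊔ Ideal.span {algebraMap A B u})) =
      localizedLength P₀ (B ⧸ Q.asIdeal) * PrimeCycle.localLength P₀ u q := by
  have hmem (x : A) : x ∈ P₀.asIdeal ↔ algebraMap A B x ∈ Q.asIdeal := by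
    rw [← hP₀]
    exact Iff.rfl
  obtain ⟨-, h⟩ := localizedLength_coker_smul q P₀.asIdeal u {P₀} (M := B ⧸ Q.asIdeal)
    (by simpa using hu)
    (fun P hP Q hQ hQP => by
      rw [Finset.mem_singleton.1 hP] at hQP ⊢
      exact le_antisymm hQP hQ)
    (fun P hP hne => localizedLength_ne_top q fun r hr =>
      localizedLength_quotient_eq_zero r fun hle => by
        have h1 := δ.dim_lt_of_lt P P₀ (lt_of_le_of_ne hP fun h => hne (by simp [h]))
        have h2 := δ.dim_lt_of_lt q r hr
        have h3 := δ.dim_le_of_le (show P ≤ r from hle)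
        omega)
    (fun x hx m => by
      obtain ⟨m, rfl⟩ := Ideal.Quotient.mk_surjective m
      rw [← algebraMap_smul B x]
      exact Ideal.Quotient.eq_zero_iff_mem.2 (Ideal.mul_mem_right _ _ ((hmem x).1 hx)))
  have hlsmul : Algebra.lsmul A A (B ⧸ Q.asIdeal) u =
      Algebra.lsmul A A (B ⧸ Q.asIdeal) (algebraMap A B u) :=
    LinearMap.ext fun x => (algebraMap_smul B u x).symm
  have hker : LinearMap.ker (Algebra.lsmul A A (B ⧸ Q.asIdeal) (algebraMap A B u)) = ⊥ := by
    refine (Submodule.eq_bot_iff _).2 fun x hx => ?_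
    obtain ⟨x, rfl⟩ := Ideal.Quotient.mk_surjective x
    have hx' : Ideal.Quotient.mk Q.asIdeal (algebraMap A B u * x) = 0 := hx
    rw [Ideal.Quotient.eq_zero_iff_mem] at hx' ⊢
    exact (Q.isPrime.mem_or_mem hx').resolve_left fun h => hu ((hmem u).2 h)
  rw [hlsmul, localizedLength_coker_quotient, hker,
    localizedLength_eq_zero_of_subsingleton q (M := (⊥ : Submodule A (B ⧸ Q.asIdeal))), zero_add,
    Finset.sum_singleton] at h
  rw [h, PrimeCycle.localLength_eq]

end Comparison

/-! ### Iterated intersections through a birational finite extension. -/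

section DoubleCap

variable {A : Type*} [CommRing A] [IsNoetherianRing A] {δ : DimensionFunction A}
  {B : Type*} [CommRing B] [IsDomain B] [Algebra A B] [Module.Finite A B]
  {p : PrimeSpectrum A} (hp : PrimeSpectrum.comap (algebraMap A B) ⊥ = p)
include hp

theorem localLength_toNat_eq_sum
    (hbir : ∀ b : B, ∃ a ∉ p.asIdeal, ∃ c : A, a • b = algebraMap A B c) {v : A}
    (hv : v ∉ p.asIdeal) (s : Finset (PrimeSpectrum B))
    (hs : ∀ Q, Q ∈ s ↔ δ.IsDivisorial Q ∧ algebraMap A B v ∈ Q.asIdeal) {P : PrimeSpectrum A}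
    (hP : δ.dim p = δ.dim P + 1) :
    (PrimeCycle.localLength p v P).toNat =
      ∑ Q ∈ s, primeOrder Q (algebraMap A B v) * (localizedLength P (B ⧸ Q.asIdeal)).toNat := by
  have : IsNoetherianRing B := IsNoetherianRing.of_finite A B
  have hv' : algebraMap A B v ≠ 0 := fun h => hv ((algebraMap_eq_zero_iff_mem hp v).1 h)
  rw [localLength_eq_localizedLength_of_birational hp hbir hv hP,
    localizedLength_quotient_span_eq_sum hp hv' s hs hP, ← ENat.toNat_natCast (∑ Q ∈ s, _)]
  congr 1
  rw [Nat.cast_sum]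
  refine Finset.sum_congr rfl fun Q hQ => ?_
  have hd := ((hs Q).1 hQ).1
  have hfin : localizedLength P (B ⧸ Q.asIdeal) ≠ ⊤ := by
    by_cases hle : PrimeSpectrum.comap (algebraMap A B) Q ≤ P
    · rw [← δ.eq_of_le_of_dim_eq hle (by have := hd.dim_eq hp; omega)]
      exact localizedLength_comap_self_ne_top Q
    · rw [localizedLength_quotient_eq_zero_of_comap hle]
      exact ENat.zero_ne_top
  rw [Nat.cast_mul, primeOrder,
    ENat.natCast_toNat (localizedLength_quotient_span_ne_top hd.isAtom hv'),
    ENat.natCast_toNat hfin]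

-- Expand `div(p, v)` through the divisorial primes `Q` of `B`, collect the terms by `Q`, and absorb
-- the generic length of `B / Q` along its contraction into the length of `B / (Q, u)`.
open Classical in
theorem PrimeCycle.incl_cap_div_apply
    (hbir : ∀ b : B, ∃ a ∉ p.asIdeal, ∃ c : A, a • b = algebraMap A B c) {u v : A}
    (hv : v ∉ p.asIdeal) (s : Finset (PrimeSpectrum B))
    (hs : ∀ Q, Q ∈ s ↔ δ.IsDivisorial Q ∧ algebraMap A B v ∈ Q.asIdeal) (q : PrimeSpectrum A) :
    PrimeCycle.incl (Ideal.span {u}) (PrimeCycle.cap δ u (PrimeCycle.div δ p v hv)) q =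
      if δ.dim p = δ.dim q + 2 then
        ∑ Q ∈ s, if algebraMap A B u ∈ Q.asIdeal then (0 : ℤ) else
          (primeOrder Q (algebraMap A B v) * residueOrder q Q (algebraMap A B u) : ℕ)
      else 0 := by
  set c := PrimeSpectrum.comap (algebraMap A B) with hc
  set D := PrimeCycle.div δ p v hv with hD
  set w : PrimeSpectrum A → ℤ := fun P => if u ∈ P.asIdeal then 0 else
    if δ.dim P = δ.dim q + 1 then ((PrimeCycle.localLength P u q).toNat : ℤ) else 0 with hw
  have hsc {Q} (hQ : Q ∈ s) : δ.dim p = δ.dim (c Q) + 1 := ((hs Q).1 hQ).1.dim_eq hp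
  have hT {P} (hP : P ∈ D.support ∪ s.image c) : δ.dim p = δ.dim P + 1 := by
    rcases Finset.mem_union.1 hP with h | h
    · by_contra hne
      rw [Finsupp.mem_support_iff, hD, PrimeCycle.div_apply, if_neg hne] at h
      exact h rfl
    · obtain ⟨Q, hQ, rfl⟩ := Finset.mem_image.1 h
      exact hsc hQ
  rw [PrimeCycle.incl_cap_apply, Finset.sum_subset (Finset.subset_union_left (s₂ := s.image c))
    fun P _ hP => by rw [Finsupp.notMem_support_iff.1 hP, zero_mul]]
  have hterm : ∀ P ∈ D.support ∪ s.image c, D P * w P = ∑ Q ∈ s,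
      (primeOrder Q (algebraMap A B v) : ℤ) *
        ((localizedLength P (B ⧸ Q.asIdeal)).toNat * w P) := by
    intro P hP
    rw [hD, PrimeCycle.div_apply, if_pos (hT hP), localLength_toNat_eq_sum hp hbir hv s hs (hT hP),
      Nat.cast_sum, Finset.sum_mul]
    refine Finset.sum_congr rfl fun Q _ => ?_
    push_cast
    ring
  rw [Finset.sum_congr rfl hterm, Finset.sum_comm]
  have hsum : ∀ Q ∈ s, (∑ P ∈ D.support ∪ s.image c, (primeOrder Q (algebraMap A B v) : ℤ) *
      ((localizedLength P (B ⧸ Q.asIdeal)).toNat * w P)) =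
      (primeOrder Q (algebraMap A B v) : ℤ) *
        ((localizedLength (c Q) (B ⧸ Q.asIdeal)).toNat * w (c Q)) := by
    intro Q hQ
    -- All primes `P` in the sum have the dimension of `c Q`, and `B / Q` vanishes at `P` unless `c
    -- Q ≤ P`; so only `P = c Q` contributes.
    refine Finset.sum_eq_single (c Q) (fun P hP hne => ?_) fun h =>
      absurd (Finset.mem_union_right _ (Finset.mem_image_of_mem c hQ)) h
    rw [localizedLength_quotient_eq_zero_of_comap (q := P), ENat.toNat_zero, Nat.cast_zero,
      zero_mul, mul_zero]
    intro hle
    exact hne (δ.eq_of_le_of_dim_eq (p := c Q) hle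
      (by have := hT hP; have := hsc hQ; omega)).symm
  rw [Finset.sum_congr rfl hsum]
  split_ifs with hq
  · refine Finset.sum_congr rfl fun Q hQ => ?_
    have hmem : u ∈ (c Q).asIdeal ↔ algebraMap A B u ∈ Q.asIdeal := Iff.rfl
    have hdim : δ.dim (c Q) = δ.dim q + 1 := by have := hsc hQ; omega
    by_cases hu : algebraMap A B u ∈ Q.asIdeal
    · rw [hw]
      simp [hmem, hu]
    · rw [hw, if_neg hu, residueOrder,
        localizedLength_residue_eq_mul rfl (fun h => hu (hmem.1 h)) hdim, ENat.toNat_mul]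
      simp only [hmem, hu, if_false, hdim, if_true]
      push_cast
      rfl
  · refine Finset.sum_eq_zero fun Q hQ => ?_
    have : w (c Q) = 0 := by
      simp only [hw]
      split_ifs with h1 h2
      · rfl
      · have := hsc hQ
        omega
      · rfl
    rw [this, mul_zero, mul_zero]

-- The residue orders of `c` form `m` times the divisor of `a / b`, where `a` and `b` come from the
-- norm applied to `B / Q` over `A`. The contraction of `Q` contains `I`, so these divisors are
-- defined on `A / I`.
open Classical in
theorem exists_ratTrivial_residueOrder (I : Ideal A) {Q : PrimeSpectrum B}
    (hQ : δ.IsDivisorial Q) (hI : I ≤ Q.asIdeal.comap (algebraMap A B)) {c : B}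
    (hc : c ∉ Q.asIdeal) :
    ∃ z ∈ PrimeCycle.ratTrivial (δ.quotient I) (δ.dim p - 2), ∀ q : PrimeSpectrum A,
      PrimeCycle.incl I z q = if δ.dim p = δ.dim q + 2 then (residueOrder q Q c : ℤ) else 0 := by
  obtain ⟨P, hP⟩ : PrimeSpectrum.comap (algebraMap A B) Q ∈
      Set.range (PrimeSpectrum.comap (Ideal.Quotient.mk I)) := by
    rw [range_comap_of_surjective _ _ Ideal.Quotient.mk_surjective, Ideal.mk_ker]
    exact hI
  have hdim := hQ.dim_eq hp
  rw [← hP] at hdim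
  have hker : RingHom.ker (algebraMap A (B ⧸ Q.asIdeal)) =
      (PrimeSpectrum.comap (Ideal.Quotient.mk I) P).asIdeal := by
    rw [hP]
    ext x
    exact Ideal.Quotient.eq_zero_iff_mem
  obtain ⟨m, a, b, ha, hb, hab⟩ := exists_localizedLength_eq_norm (A := A)
    (y := Ideal.Quotient.mk Q.asIdeal c) (fun h => hc (Ideal.Quotient.eq_zero_iff_mem.1 h)) hker
  have hmem (x : A) (hx : x ∉ (PrimeSpectrum.comap (Ideal.Quotient.mk I) P).asIdeal) :
      PrimeCycle.div (δ.quotient I) P (Ideal.Quotient.mk I x) hx ∈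
        PrimeCycle.ratTrivial (δ.quotient I) (δ.dim p - 2) :=
    AddSubgroup.subset_closure ⟨P, _, hx, by
      change δ.dim (PrimeSpectrum.comap (Ideal.Quotient.mk I) P) = _
      omega, rfl⟩
  refine ⟨_, sub_mem (nsmul_mem (hmem a ha) m) (nsmul_mem (hmem b hb) m), fun q => ?_⟩
  rw [map_sub, map_nsmul, map_nsmul, PrimeCycle.incl_div I P a ha ha,
    PrimeCycle.incl_div I P b hb hb, Finsupp.sub_apply, Finsupp.smul_apply, Finsupp.smul_apply,
    PrimeCycle.div_apply, PrimeCycle.div_apply]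
  by_cases hq : δ.dim p = δ.dim q + 2
  · have hq' : δ.dim (PrimeSpectrum.comap (Ideal.Quotient.mk I) P) = δ.dim q + 1 := by omega
    rw [if_pos hq', if_pos hq', if_pos hq]
    have h := hab q fun r hr hPr => (δ.eq_of_le_of_dim_eq hPr (by
      have h1 := δ.dim_lt_of_lt _ _ hr
      have h2 := δ.dim_le_of_le hPr
      omega)).symm
    have hfin := localizedLength_residue_ne_top (δ := δ) (q := q) (by rw [hp]; exact hq) hQ hc
    have hsurj : Function.Surjective (algebraMap B (B ⧸ Q.asIdeal)) :=
      Ideal.Quotient.mk_surjective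
    have hres : localizedLength q ((B ⧸ Q.asIdeal) ⧸ Ideal.span {Ideal.Quotient.mk Q.asIdeal c}) =
        (residueOrder q Q c : ℕ∞) := by
      rw [residueOrder, ENat.natCast_toNat hfin, localizedLength_quotient_comap (B := B) q hsurj,
        ← Set.image_singleton, ← Ideal.map_span]
      change localizedLength q (B ⧸ Ideal.comap (Ideal.Quotient.mk Q.asIdeal) _) = _
      rw [Ideal.comap_map_of_surjective _ Ideal.Quotient.mk_surjective, sup_comm]
      congr 3 <;> exact Ideal.mk_ker
    rw [hres, ← PrimeCycle.localLength_eq, ← PrimeCycle.localLength_eq,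
      ← ENat.natCast_toNat (PrimeCycle.localLength_ne_top δ ha hq'),
      ← ENat.natCast_toNat (PrimeCycle.localLength_ne_top δ hb hq')] at h
    have h' : residueOrder q Q c +
        m * (PrimeCycle.localLength (PrimeSpectrum.comap (Ideal.Quotient.mk I) P) b q).toNat =
        m * (PrimeCycle.localLength (PrimeSpectrum.comap (Ideal.Quotient.mk I) P) a q).toNat := by
      exact_mod_cast h
    rw [nsmul_eq_mul, nsmul_eq_mul, sub_eq_iff_eq_add]
    exact_mod_cast h'.symm
  · have hq' : ¬ δ.dim (PrimeSpectrum.comap (Ideal.Quotient.mk I) P) = δ.dim q + 1 := by omega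
    rw [if_neg hq', if_neg hq', if_neg hq, smul_zero, sub_self]

end DoubleCap

/-! ### Commutativity of the two intersections. -/

section Commutativity

variable {A : Type*} [CommRing A] [IsNoetherianRing A] {δ : DimensionFunction A}

theorem tameSum_eq_sum {B : Type*} [CommRing B] [IsDomain B] [IsIntegrallyClosed B] [Algebra A B]
    [Module.Finite A B] {q : PrimeSpectrum A}
    (hq : δ.dim (PrimeSpectrum.comap (algebraMap A B) ⊥) = δ.dim q + 2) {u v : B} (hu : u ≠ 0)
    (hv : v ≠ 0) (s : Finset (PrimeSpectrum B))
    (hs : ∀ P, P ∈ s ↔ δ.IsDivisorial P ∧ u * v ∈ P.asIdeal) :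
    tameSum δ q u v = ∑ P ∈ s, tameOrder q P u v := by
  have : IsNoetherianRing B := IsNoetherianRing.of_finite A B
  rw [tameSum]
  refine finsum_mem_eq_sum_of_inter_support_eq _ ?_
  ext P
  simp only [Set.mem_inter_iff, Set.mem_ofPred_eq, Finset.mem_coe]
  refine ⟨fun ⟨hP, h⟩ => ⟨?_, h⟩, fun ⟨hP, h⟩ => ⟨((hs P).1 hP).1, h⟩⟩
  by_contra h'
  exact h (tameOrder_eq_zero hq hP hu hv fun h'' => h' ((hs P).2 ⟨hP, h''⟩))

-- The witness is minus the sum, over divisorial `Q` containing both `u` and `v`, of the divisors of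
-- the norms of the tame symbols. Reciprocity equates it with the contribution of the remaining `Q`,
-- which is the difference of the iterated intersections.
open Classical in
theorem exists_ratTrivial_incl_eq_of_normal {B : Type*} [CommRing B] [IsDomain B]
    [IsIntegrallyClosed B] [Algebra A B] [Module.Finite A B] {p : PrimeSpectrum A}
    (hp : PrimeSpectrum.comap (algebraMap A B) ⊥ = p)
    (hbir : ∀ b : B, ∃ a ∉ p.asIdeal, ∃ c : A, a • b = algebraMap A B c) {u v : A}
    (hu : u ∉ p.asIdeal) (hv : v ∉ p.asIdeal) :
    ∃ ξ ∈ PrimeCycle.ratTrivial (δ.quotient (Ideal.span {u, v})) (δ.dim p - 2),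
      PrimeCycle.incl (Ideal.span {u, v}) ξ =
        PrimeCycle.incl (Ideal.span {u}) (PrimeCycle.cap δ u (PrimeCycle.div δ p v hv)) -
        PrimeCycle.incl (Ideal.span {v}) (PrimeCycle.cap δ v (PrimeCycle.div δ p u hu)) := by
  have : IsNoetherianRing B := IsNoetherianRing.of_finite A B
  set I : Ideal A := Ideal.span {u, v}
  set x := algebraMap A B u
  set y := algebraMap A B v
  have hx : x ≠ 0 := fun h => hu ((algebraMap_eq_zero_iff_mem hp u).1 h)
  have hy : y ≠ 0 := fun h => hv ((algebraMap_eq_zero_iff_mem hp v).1 h)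
  have hfin (x : B) (hx : x ≠ 0) : ∃ s : Finset (PrimeSpectrum B),
      ∀ P, P ∈ s ↔ δ.IsDivisorial P ∧ x ∈ P.asIdeal :=
    ⟨(finite_isDivisorial_mem (δ := δ) hx).toFinset, fun P => by simp⟩
  obtain ⟨su, hsu⟩ := hfin x hx
  obtain ⟨sv, hsv⟩ := hfin y hy
  have hz (Q : PrimeSpectrum B) : ∃ z ∈ PrimeCycle.ratTrivial (δ.quotient I) (δ.dim p - 2),
      Q ∈ su ∩ sv → ∀ q : PrimeSpectrum A, PrimeCycle.incl I z q =
        if δ.dim p = δ.dim q + 2 then tameOrder q Q x y else 0 := by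
    by_cases hQ : Q ∈ su ∩ sv
    · obtain ⟨hQu, hQv⟩ := Finset.mem_inter.1 hQ
      obtain ⟨hd, hQu⟩ := (hsu Q).1 hQu
      have hQv := ((hsv Q).1 hQv).2
      have hI : I ≤ Q.asIdeal.comap (algebraMap A B) := by
        rw [Ideal.span_le, Set.insert_subset_iff, Set.singleton_subset_iff]
        exact ⟨hQu, hQv⟩
      have hts := isTameSymbol_tameSymbol hd.isAtom hx hy
      obtain ⟨z₁, hz₁, h₁⟩ := exists_ratTrivial_residueOrder hp I hd hI hts.1
      obtain ⟨z₂, hz₂, h₂⟩ := exists_ratTrivial_residueOrder hp I hd hI hts.2.1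
      refine ⟨z₁ - z₂, sub_mem hz₁ hz₂, fun _ q => ?_⟩
      rw [map_sub, Finsupp.sub_apply, h₁, h₂, tameOrder]
      split_ifs
      · rfl
      · exact sub_zero 0
    · exact ⟨0, zero_mem _, fun h => absurd h hQ⟩
  choose z hz hz' using hz
  refine ⟨-∑ Q ∈ su ∩ sv, z Q, neg_mem (sum_mem fun Q _ => hz Q), ?_⟩
  ext q
  rw [map_neg, map_sum, Finsupp.neg_apply, Finsupp.finsetSum_apply, Finsupp.sub_apply,
    PrimeCycle.incl_cap_div_apply hp hbir hv sv hsv, PrimeCycle.incl_cap_div_apply hp hbir hu su hsu,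
    Finset.sum_congr rfl fun Q hQ => hz' Q hQ q]
  split_ifs with hq
  · rw [← hp] at hq
    have hmem (Q) : Q ∈ su ∪ sv ↔ δ.IsDivisorial Q ∧ x * y ∈ Q.asIdeal := by
      rw [Finset.mem_union, hsu, hsv, ← and_or_left, Q.isPrime.mul_mem_iff_mem_or_mem]
    have h0 := tameSum_eq_zero hq hx hy
    rw [tameSum_eq_sum hq hx hy _ hmem] at h0
    -- A prime containing both elements contributes its tame order to the first summand only. Any
    -- other contributes `ord(v) · res(u) - ord(u) · res(v)`, which is the term of the two cycles at
    -- `Q`.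
    have hsplit (Q) (hQ : Q ∈ su ∪ sv) : tameOrder q Q x y =
        (if Q ∈ su ∩ sv then tameOrder q Q x y else 0) +
        ((if Q ∈ sv then if x ∈ Q.asIdeal then (0 : ℤ) else
          (primeOrder Q y * residueOrder q Q x : ℕ) else 0) -
        (if Q ∈ su then if y ∈ Q.asIdeal then (0 : ℤ) else
          (primeOrder Q x * residueOrder q Q y : ℕ) else 0)) := by
      have hd := ((hmem Q).1 hQ).1
      by_cases h : x ∈ Q.asIdeal → y ∉ Q.asIdeal
      · rw [tameOrder_eq_sub hq hd hx hy h]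
        by_cases hxQ : x ∈ Q.asIdeal
        · simp [hsu, hsv, hd, hxQ, h hxQ, primeOrder_eq_zero (h hxQ)]
        · by_cases hyQ : y ∈ Q.asIdeal
          · simp [hsu, hsv, hd, hxQ, hyQ, primeOrder_eq_zero hxQ]
          · simp [hsu, hsv, hxQ, hyQ, primeOrder_eq_zero hxQ, primeOrder_eq_zero hyQ]
      · push Not at h
        simp [hsu, hsv, hd, h.1, h.2]
    rw [Finset.sum_congr rfl hsplit, Finset.sum_add_distrib, Finset.sum_sub_distrib,
      ← Finset.sum_filter, ← Finset.sum_filter, ← Finset.sum_filter, Finset.filter_mem_eq_inter,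
      Finset.filter_mem_eq_inter, Finset.filter_mem_eq_inter, Finset.union_inter_cancel_left,
      Finset.union_inter_cancel_right, Finset.inter_eq_right.2
        (Finset.inter_subset_left.trans Finset.subset_union_left)] at h0
    linarith
  · simp

/-- The normalization of `A/p` serves as `B`: it is finite by `hA`, and elements of the fraction
field have denominators from `A` outside `p`. -/
theorem exists_ratTrivial_incl_eq {p : PrimeSpectrum A}
    (hA : Module.Finite (A ⧸ p.asIdeal)
      (integralClosure (A ⧸ p.asIdeal) (FractionRing (A ⧸ p.asIdeal)))) {u v : A}
    (hu : u ∉ p.asIdeal) (hv : v ∉ p.asIdeal) :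
    ∃ ξ ∈ PrimeCycle.ratTrivial (δ.quotient (Ideal.span {u, v})) (δ.dim p - 2),
      PrimeCycle.incl (Ideal.span {u, v}) ξ =
        PrimeCycle.incl (Ideal.span {u}) (PrimeCycle.cap δ u (PrimeCycle.div δ p v hv)) -
        PrimeCycle.incl (Ideal.span {v}) (PrimeCycle.cap δ v (PrimeCycle.div δ p u hu)) := by
  let R := A ⧸ p.asIdeal
  let B := integralClosure R (FractionRing R)
  let : Algebra A B := ((algebraMap R B).comp (algebraMap A R)).toAlgebra
  have : IsScalarTower A R B := .of_algebraMap_eq fun _ => rfl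
  have : Module.Finite A B := Module.Finite.trans R B
  have : IsIntegrallyClosed B := integralClosure.isIntegrallyClosedOfFiniteExtension (FractionRing R)
  have hinj : Function.Injective (algebraMap R B) := FaithfulSMul.algebraMap_injective R B
  refine exists_ratTrivial_incl_eq_of_normal (B := B) (p := p) ?_ (fun b => ?_) hu hv
  · ext x
    change algebraMap R B (algebraMap A R x) = 0 ↔ _
    rw [map_eq_zero_iff _ hinj]
    exact Ideal.Quotient.eq_zero_iff_mem
  · obtain ⟨c, a, h⟩ := IsLocalization.exists_mk'_eq (nonZeroDivisors R) (b : FractionRing R)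
    obtain ⟨c, rfl⟩ := Ideal.Quotient.mk_surjective c
    obtain ⟨a, ha⟩ := a
    obtain ⟨a, rfl⟩ := Ideal.Quotient.mk_surjective a
    refine ⟨a, fun h0 => nonZeroDivisors.ne_zero ha (Ideal.Quotient.eq_zero_iff_mem.2 h0), c, ?_⟩
    apply Subtype.ext
    have := IsLocalization.mk'_spec (FractionRing R) (Ideal.Quotient.mk p.asIdeal c)
      ⟨Ideal.Quotient.mk p.asIdeal a, ha⟩
    rw [h] at this
    rw [Algebra.smul_def, mul_comm]
    exact this

-- Used twice: to kill the degenerate case `u ∈ p`, and to place the iterated intersection on `A /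
-- (u, v)` in dimension `dim p - 2`.
open Classical in
theorem PrimeCycle.le_of_incl_cap_div_ne_zero {p : PrimeSpectrum A} {u v : A} (hv : v ∉ p.asIdeal)
    {q : PrimeSpectrum A}
    (h : PrimeCycle.incl (Ideal.span {u}) (PrimeCycle.cap δ u (PrimeCycle.div δ p v hv)) q ≠ 0) :
    u ∉ p.asIdeal ∧ Ideal.span {u, v} ≤ q.asIdeal ∧ δ.dim p = δ.dim q + 2 := by
  rw [PrimeCycle.incl_cap_apply] at h
  obtain ⟨P, -, hP⟩ := Finset.exists_ne_zero_of_sum_ne_zero h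
  have h1 := left_ne_zero_of_mul hP
  have h2 := right_ne_zero_of_mul hP
  have hle := PrimeCycle.le_of_div_apply_ne_zero hv h1
  rw [PrimeCycle.div_apply] at h1
  have hd1 := (ite_ne_right_iff.1 h1).1
  obtain ⟨huP, h2⟩ := ite_ne_left_iff.1 h2
  obtain ⟨hd2, h2⟩ := ite_ne_right_iff.1 (Ne.symm h2)
  have hle' := PrimeCycle.le_of_localLength_ne_zero (p := P) (x := u) (q := q)
    fun h0 => h2 (by simp [h0])
  refine ⟨fun hup => huP (hle (le_sup_left (a := p.asIdeal) hup)), ?_, by omega⟩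
  rw [Ideal.span_le, Set.insert_subset_iff, Set.singleton_subset_iff]
  exact ⟨hle' (le_sup_right (a := P.asIdeal) (Ideal.mem_span_singleton_self u)),
    hle' (le_sup_left (a := P.asIdeal)
      (hle (le_sup_right (a := p.asIdeal) (Ideal.mem_span_singleton_self v))))⟩

omit [IsNoetherianRing A] in
theorem PrimeCycle.exists_incl_eq (I : Ideal A) {i : ℤ} (c : PrimeCycle A)
    (hc : ∀ q, c q ≠ 0 → I ≤ q.asIdeal ∧ δ.dim q = i) :
    ∃ β ∈ PrimeCycle.ofDim (δ.quotient I) i, PrimeCycle.incl I β = c := by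
  refine ⟨c.comapDomain _ (PrimeCycle.comap_mk_injective I).injOn, ?_,
    Finsupp.mapDomain_comapDomain _ (PrimeCycle.comap_mk_injective I) _ fun q hq => ?_⟩
  · refine (Finsupp.mem_supported ℤ _).2 fun q hq => ?_
    exact (hc (PrimeSpectrum.comap (Ideal.Quotient.mk I) q)
      (by simpa [Finsupp.comapDomain_apply] using hq)).2
  · rw [range_comap_of_surjective _ _ Ideal.Quotient.mk_surjective, Ideal.mk_ker]
    exact (hc q (Finsupp.mem_support_iff.1 hq)).1

open Classical in
theorem exists_ratEquiv_single {p : PrimeSpectrum A}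
    (hA : Module.Finite (A ⧸ p.asIdeal)
      (integralClosure (A ⧸ p.asIdeal) (FractionRing (A ⧸ p.asIdeal)))) (u v : A) :
    ∃ β γ : PrimeCycle (A ⧸ Ideal.span {u, v}),
      PrimeCycle.incl (Ideal.span {u, v}) β =
        PrimeCycle.incl (Ideal.span {u}) (PrimeCycle.cap δ u
          (PrimeCycle.incl (Ideal.span {v}) (PrimeCycle.cap δ v (Finsupp.single p 1)))) ∧
      PrimeCycle.incl (Ideal.span {u, v}) γ =
        PrimeCycle.incl (Ideal.span {v}) (PrimeCycle.cap δ v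
          (PrimeCycle.incl (Ideal.span {u}) (PrimeCycle.cap δ u (Finsupp.single p 1)))) ∧
      PrimeCycle.RatEquiv (δ.quotient (Ideal.span {u, v})) (δ.dim p - 2) β γ := by
  have hdeg {u v : A} (hv : v ∉ p.asIdeal) (hu : u ∈ p.asIdeal) :
      PrimeCycle.incl (Ideal.span {u}) (PrimeCycle.cap δ u (PrimeCycle.div δ p v hv)) = 0 := by
    ext q
    by_contra h
    exact (PrimeCycle.le_of_incl_cap_div_ne_zero hv h).1 hu
  have hzero : PrimeCycle.RatEquiv (δ.quotient (Ideal.span {u, v})) (δ.dim p - 2) 0 0 :=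
    ⟨zero_mem _, zero_mem _, by rw [sub_zero]; exact zero_mem _⟩
  simp only [PrimeCycle.incl_cap_single, one_smul]
  by_cases hu : u ∈ p.asIdeal
  · by_cases hv : v ∈ p.asIdeal
    · exact ⟨0, 0, by simp [hv], by simp [hu], hzero⟩
    · exact ⟨0, 0, by simp [hv, hdeg hv hu], by simp [hu], hzero⟩
  · by_cases hv : v ∈ p.asIdeal
    · exact ⟨0, 0, by simp [hv], by simp [hu, hdeg hu hv], hzero⟩
    · rw [dif_neg hu, dif_neg hv]
      obtain ⟨ξ, hξ, h⟩ := exists_ratTrivial_incl_eq (δ := δ) hA hu hv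
      obtain ⟨β, hβ, h₁⟩ := PrimeCycle.exists_incl_eq (δ := δ) (i := δ.dim p - 2)
        (Ideal.span {u, v}) _ fun q hq =>
          ⟨(PrimeCycle.le_of_incl_cap_div_ne_zero (δ := δ) (u := u) hv hq).2.1, by
            have := (PrimeCycle.le_of_incl_cap_div_ne_zero (δ := δ) hv hq).2.2
            omega⟩
      obtain ⟨γ, hγ, h₂⟩ := PrimeCycle.exists_incl_eq (δ := δ) (i := δ.dim p - 2)
        (Ideal.span {u, v}) _ fun q hq =>
          ⟨Set.pair_comm u v ▸ (PrimeCycle.le_of_incl_cap_div_ne_zero (δ := δ) (u := v) hu hq).2.1, by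
            have := (PrimeCycle.le_of_incl_cap_div_ne_zero (δ := δ) hu hq).2.2
            omega⟩
      refine ⟨β, γ, h₁, h₂, hβ, hγ, ?_⟩
      -- The inclusion of cycles is injective, so the identity in `A` identifies `β - γ` with the
      -- rationally trivial cycle `ξ`.
      rwa [← Finsupp.mapDomain_injective (PrimeCycle.comap_mk_injective (Ideal.span {u, v}))
        (a₁ := ξ) (a₂ := β - γ)]
      change PrimeCycle.incl _ _ = PrimeCycle.incl _ _
      rw [map_sub, h₁, h₂, h]

end Commutativity

theorem theorem1p5 {A : Type*} [CommRing A] [IsNoetherianRing A] (δ : DimensionFunction A)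
    (hA : ∀ p : PrimeSpectrum A, Module.Finite (A ⧸ p.asIdeal)
      (integralClosure (A ⧸ p.asIdeal) (FractionRing (A ⧸ p.asIdeal))))
    (u v : A) (i : ℤ) (α : PrimeCycle A) (hα : α ∈ PrimeCycle.ofDim δ i) :
    ∃ β γ : PrimeCycle (A ⧸ Ideal.span {u, v}),
      PrimeCycle.incl (Ideal.span {u, v}) β =
        PrimeCycle.incl (Ideal.span {u})
          (PrimeCycle.cap δ u (PrimeCycle.incl (Ideal.span {v}) (PrimeCycle.cap δ v α))) ∧
      PrimeCycle.incl (Ideal.span {u, v}) γ =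
        PrimeCycle.incl (Ideal.span {v})
          (PrimeCycle.cap δ v (PrimeCycle.incl (Ideal.span {u}) (PrimeCycle.cap δ u α))) ∧
      PrimeCycle.RatEquiv (δ.quotient (Ideal.span {u, v})) (i - 2) β γ := by
  choose β γ hβ hγ h using fun p => exists_ratEquiv_single (δ := δ) (hA p) u v
  have hdim {p} (hp : p ∈ α.support) : δ.dim p = i := (Finsupp.mem_supported ℤ α).1 hα hp
  have hsum : α = ∑ p ∈ α.support, α p • Finsupp.single p (1 : ℤ) := by
    conv_lhs => rw [← Finsupp.sum_single α, Finsupp.sum]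
    refine Finset.sum_congr rfl fun p _ => ?_
    rw [Finsupp.smul_single_one]
  refine ⟨∑ p ∈ α.support, α p • β p, ∑ p ∈ α.support, α p • γ p, ?_, ?_,
    sum_mem fun p hp => zsmul_mem (hdim hp ▸ (h p).1) _,
    sum_mem fun p hp => zsmul_mem (hdim hp ▸ (h p).2.1) _, ?_⟩
  · conv_rhs => rw [hsum]
    simp only [map_sum, map_zsmul, hβ]
  · conv_rhs => rw [hsum]
    simp only [map_sum, map_zsmul, hγ]
  · rw [← Finset.sum_sub_distrib]
    simp only [← zsmul_sub]
    exact sum_mem fun p hp => zsmul_mem (hdim hp ▸ (h p).2.2) _
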